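/- **Setting.** Let $\mathfrak g$ be the Lie algebra of divergence-free vector fields on $\mathbb R^3$ that are rapidly decreasing at infinity (Schwartz fields), with the commutator bracket $[\mathbf b,\mathbf c]=(\mathbf b\cdot\nabla)\mathbf c-(\mathbf c\cdot\nabla)\mathbf b=-\operatorname{curl}(\mathbf b\times\mathbf c)$, acting infinitesimally on $\mathbb R^3$ with fundamental vector fields $v_{\mathbf b}=\mathbf b$. Let $\nu=dx\wedge dy\wedge dz$, which is a 2-plectic form (closed, and $X\mapsto\iota_X\nu$ is injective). Let $\delta$ be the codifferential ($\delta=-\operatorname{div}$ on 1-forms) and $\Delta=d\delta+\delta d$ the nonnegative Laplacian; for a function $\varphi$, $u=\Delta^{-1}\varphi$ denotes the smooth function $u$ vanishing at infinity with $\Delta u=\varphi$. Every $\mathbf b\in\mathfrak g$ has exactly one smooth vector potential $\mathbf B$ with $\operatorname{curl}\mathbf B=\mathbf b$, $\operatorname{div}\mathbf B=0$ and $\mathbf B\to0$ at infinity; put $B=\mathbf B^\flat$. A homotopy co-momentum map for $\nu$ is a pair of linear maps $f_1:\mathfrak g\to\Omega^1(\mathbb R^3)$, $f_2:\Lambda^2\mathfrak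 g\to\Omega^0(\mathbb R^3)$ into smooth forms, with $f_1$ taking values in Hamiltonian 1-forms (those $H$ with $\iota_X\nu+dH=0$ for some $\nu$-preserving field $X$), such that, with $f_0=f_3=0$ and $\varsigma(k)=-(-1)^{k(k+1)/2}$, $$-f_{k-1}(\partial p)=d f_k(p)+\varsigma(k)\,\iota(v_p)\nu\qquad(p\in\Lambda^k\mathfrak g,\ k=1,2,3),$$ where $\iota(v_{\xi_1\wedge\dots\wedge\xi_k})=\iota_{\xi_k}\cdots\iota_{\xi_1}$ and $\partial(\xi_1\wedge\dots\wedge\xi_k)=\sum_{i<j}(-1)^{i+j}[\xi_i,\xi_j]\wedge\xi_1\wedge\dots\hat\xi_i\dots\hat\xi_j\dots\wedge\xi_k$. Let $Y$ be the space of smooth oriented knots (smooth embeddings $\gamma:S^1=\mathbb R/\mathbb Z\to\mathbb R^3$ modulo orientation-preserving reparametrization), with the 2-form represented by $\Omega_\gamma(u,v)=\int_0^1\nu(\dot\gamma,u,v)\,dt$ on vector fields along $\gamma$. **Theorem 2.1.** (i) The formulas $$f_1(\mathbf b)=-B,\qquad f_2(\mathbf b\wedge\mathbf c)=\Delta^{-1}\delta\mu_2(\mathbf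 b,\mathbf c),\qquad \mu_2(\mathbf b,\mathbf c)=f_1([\mathbf b,\mathbf c])-\nu(\mathbf b,\mathbf c,\cdot),$$ define (uniquely) linear maps $f_1,f_2$, and these form a homotopy co-momentum map. (ii) This map transgresses, via $\mathrm{ev}(\gamma,t)=\gamma(t)$, to the hydrodynamical (Arnol'd–Marsden–Weinstein) co-momentum map on $Y$. That is: $\Omega$ is invariant under orientation-preserving reparametrization and its kernel at a knot consists exactly of the tangential fields; for every smooth loop $\gamma$ and every smooth $\mathbf B$ with $\operatorname{curl}\mathbf B=\mathbf b$ one has $\int_{S^1}\mathrm{ev}^*f_1(\mathbf b)\,|_\gamma=-\int_\gamma\mathbf B$; on knots this equals $-\lambda_{\mathbf b}$, where the Rasetti–Regge current $\lambda_{\mathbf b}(\gamma)=\int_\gamma\mathbf B$ is a well-defined function on $Y$ linear in $\mathbf b$; and $\mu_{\mathbf b}=-\lambda_{\mathbf b}$ is a co-momentum map, i.e. $d\mu_{\mathbf b}+\iota_{\mathbf b}\Omega=0$ (along all smooth variations of knots) and $\Omega(\mathbf b,\mathbf c)=\mu_{[\mathbf b,\mathbf c]}$ on $Y$. (iii) Each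 $f_1(\mathbf b)$ is a Hamiltonian 1-form with Hamiltonian vector field $\mathbf b$, and, with $\{f_1(\mathbf b),f_1(\mathbf c)\}:=\iota_{\mathbf c}\iota_{\mathbf b}\nu=\nu(\mathbf b,\mathbf c,\cdot)$, $$\{f_1(\mathbf b),f_1(\mathbf c)\}-f_1([\mathbf b,\mathbf c])=-df_2(\mathbf b\wedge\mathbf c)\qquad(\mathbf b,\mathbf c\in\mathfrak g).$$ (iv) The map is not (infinitesimally) $G$-equivariant, $G$ being the group of volume-preserving diffeomorphisms: the identities $\mathcal L_\xi f_k(p)=f_k([\xi,p])$ for all $\xi\in\mathfrak g$, $p\in\Lambda^k\mathfrak g$, $k=1,2$, do not all hold; indeed there is $\mathbf b\in\mathfrak g$ with $\mathcal L_{\mathbf b}f_1(\mathbf b)\neq f_1([\mathbf b,\mathbf b])=0$. -/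

import Mathlib

open scoped SchwartzMap ContDiff Topology

noncomputable section

namespace Hydro

/-! ## Differential forms on a normed space -/

section Forms

variable {E : Type*} [NormedAddCommGroup E] [NormedSpace ℝ E]

/-- Smooth differential `k`-forms on `E`. -/
def SmoothForm (E : Type*) [NormedAddCommGroup E] [NormedSpace ℝ E] (k : ℕ) :
    Submodule ℝ (E → E [⋀^Fin k]→L[ℝ] ℝ) where
  carrier := {α | ContDiff ℝ ∞ α}
  add_mem' {a b} ha hb := by
    have h1 : ContDiff ℝ ∞ a := ha
    have h2 : ContDiff ℝ ∞ b := hb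
    exact h1.add h2
  zero_mem' := by
    have h : ContDiff ℝ ∞ (fun _ : E => (0 : E [⋀^Fin k]→L[ℝ] ℝ)) := contDiff_const
    exact h
  smul_mem' c a ha := by
    have h1 : ContDiff ℝ ∞ a := ha
    exact h1.const_smul c

/-- Interior product `ι_X α = α(X, ⋅, …, ⋅)`. -/
def iprod {k : ℕ} (X : E → E) (α : E → E [⋀^Fin (k + 1)]→L[ℝ] ℝ) :
    E → E [⋀^Fin k]→L[ℝ] ℝ :=
  fun x => (α x).curryLeft (X x)

/-- Lie derivative of a form of positive degree (Cartan's formula). -/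
def lieDeriv {k : ℕ} (X : E → E) (α : E → E [⋀^Fin (k + 1)]→L[ℝ] ℝ) :
    E → E [⋀^Fin (k + 1)]→L[ℝ] ℝ :=
  extDeriv (iprod X α) + iprod X (extDeriv α)

/-- Lie derivative of a `0`-form. -/
def lieDerivZero (X : E → E) (α : E → E [⋀^Fin 0]→L[ℝ] ℝ) : E → E [⋀^Fin 0]→L[ℝ] ℝ :=
  iprod X (extDeriv α)

/-- A `3`-form is `2`-plectic: smooth, closed, and `X ↦ ι_X om` is injective on smooth
vector fields. -/
structure IsTwoPlectic (om : E → E [⋀^Fin 3]→L[ℝ] ℝ) : Prop where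
  smooth : ContDiff ℝ ∞ om
  closed : extDeriv om = 0
  injective : ∀ X Y : E → E, ContDiff ℝ ∞ X → ContDiff ℝ ∞ Y →
    iprod X om = iprod Y om → X = Y

/-- `H` is a Hamiltonian `1`-form with Hamiltonian vector field `X`:
`L_X om = 0` and `ι_X om + dH = 0`. -/
structure IsHamiltonianPair (om : E → E [⋀^Fin 3]→L[ℝ] ℝ)
    (H : E → E [⋀^Fin 1]→L[ℝ] ℝ) (X : E → E) : Prop where
  smooth : ContDiff ℝ ∞ X
  preserves : lieDeriv X om = 0
  eq : iprod X om + extDeriv H = 0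

/-- The bracket `ι_Y ι_X om = om(X, Y, ⋅)` of two Hamiltonian `1`-forms with Hamiltonian vector
fields `X` and `Y`. -/
def formBracket (om : E → E [⋀^Fin 3]→L[ℝ] ℝ) (X Y : E → E) : E → E [⋀^Fin 1]→L[ℝ] ℝ :=
  iprod Y (iprod X om)

/-! ## Homotopy co-momentum maps into the Lie 2-algebra of observables -/

variable {L : Type*} [LieRing L] [LieAlgebra ℝ L]

/-- The decomposable bivector `ξ ∧ η ∈ Λ² L`. -/
def wedge (ξ η : L) : ⋀[ℝ]^2 L := exteriorPower.ιMulti ℝ 2 ![ξ, η]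

/-- `∂(ξ₁ ∧ ξ₂) = -[ξ₁, ξ₂]`, the Chevalley–Eilenberg boundary
`∑_{i<j} (-1)^{i+j} [ξᵢ, ξⱼ] ∧ ξ₁ ∧ … ∧ ξₖ` (with `ξᵢ`, `ξⱼ` omitted) for `k = 2`. -/
def boundaryTwo (ξ₁ ξ₂ : L) : L := -⁅ξ₁, ξ₂⁆

/-- `∂(ξ₁ ∧ ξ₂ ∧ ξ₃)`. -/
def boundaryThree (ξ₁ ξ₂ ξ₃ : L) : ⋀[ℝ]^2 L :=
  -wedge ⁅ξ₁, ξ₂⁆ ξ₃ + wedge ⁅ξ₁, ξ₃⁆ ξ₂ - wedge ⁅ξ₂, ξ₃⁆ ξ₁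

/-- `ς(k) = -(-1)^{k(k+1)/2}`. -/
def sig (k : ℕ) : ℝ := -(-1) ^ (k * (k + 1) / 2)

/-- `(f₁, f₂)` is a homotopy co-momentum map for the `2`-plectic form `om` and the infinitesimal
action `v` of `L` by `om`-preserving vector fields: with `f₀ = f₃ = 0` one has
`-f_{k-1}(∂p) = d f_k(p) + ς(k) ι(v_p) om` for `p ∈ Λᵏ L`, `k = 1, 2, 3`, where
`ι(v_{ξ₁ ∧ … ∧ ξₖ}) = ι(v_{ξₖ}) … ι(v_{ξ₁})`.  All three equations are linear in `p`, so they are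
stated on the decomposable elements, which span. -/
structure IsHomotopyComomentumMap (om : E → E [⋀^Fin 3]→L[ℝ] ℝ) (v : L →ₗ[ℝ] (E → E))
    (f₁ : L →ₗ[ℝ] SmoothForm E 1) (f₂ : ⋀[ℝ]^2 L →ₗ[ℝ] SmoothForm E 0) : Prop where
  action_smooth : ∀ ξ, ContDiff ℝ ∞ (v ξ)
  action_lie : ∀ ξ η, v ⁅ξ, η⁆ = VectorField.lieBracket ℝ (v ξ) (v η)
  action_preserves : ∀ ξ, lieDeriv (v ξ) om = 0
  hamiltonian : ∀ ξ, ∃ X, IsHamiltonianPair om (f₁ ξ : E → E [⋀^Fin 1]→L[ℝ] ℝ) X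
  eq_one : ∀ ξ, 0 = extDeriv (f₁ ξ : E → E [⋀^Fin 1]→L[ℝ] ℝ) + sig 1 • iprod (v ξ) om
  eq_two : ∀ ξ₁ ξ₂,
    -(f₁ (boundaryTwo ξ₁ ξ₂) : E → E [⋀^Fin 1]→L[ℝ] ℝ) =
      extDeriv (f₂ (wedge ξ₁ ξ₂) : E → E [⋀^Fin 0]→L[ℝ] ℝ) +
        sig 2 • iprod (v ξ₂) (iprod (v ξ₁) om)
  eq_three : ∀ ξ₁ ξ₂ ξ₃,
    -(f₂ (boundaryThree ξ₁ ξ₂ ξ₃) : E → E [⋀^Fin 0]→L[ℝ] ℝ) =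
      sig 3 • iprod (v ξ₃) (iprod (v ξ₂) (iprod (v ξ₁) om))

/-- Equivariance of `(f₁, f₂)`: `L_{v_ξ} f_k(p) = f_k([ξ, p])` for all `ξ ∈ L`, `p ∈ Λᵏ L`. -/
structure IsEquivariant (v : L →ₗ[ℝ] (E → E))
    (f₁ : L →ₗ[ℝ] SmoothForm E 1) (f₂ : ⋀[ℝ]^2 L →ₗ[ℝ] SmoothForm E 0) : Prop where
  one : ∀ ξ η, lieDeriv (v ξ) (f₁ η : E → E [⋀^Fin 1]→L[ℝ] ℝ) = f₁ ⁅ξ, η⁆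
  two : ∀ ξ η ζ, lieDerivZero (v ξ) (f₂ (wedge η ζ) : E → E [⋀^Fin 0]→L[ℝ] ℝ) =
    f₂ (wedge ⁅ξ, η⁆ ζ + wedge η ⁅ξ, ζ⁆)

/-- Transgression along the evaluation map `ev(γ, t) = γ(t)`: the `k`-form `∫_{S¹} ev^* α` on loop
space, evaluated at the loop `γ` on the tangent vectors `u₁, …, uₖ` (vector fields along `γ`), is
`∫₀¹ α(γ'(t), u₁(t), …, uₖ(t)) dt`. -/
def transgress {k : ℕ} (α : E → E [⋀^Fin (k + 1)]→L[ℝ] ℝ) (γ : ℝ → E)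
    (u : Fin k → ℝ → E) : ℝ :=
  ∫ t in (0 : ℝ)..1, α (γ t) (Fin.cons (deriv γ t) (fun i => u i t))

end Forms

/-! ## Vector calculus on `ℝ³` -/

/-- Euclidean 3-space. -/
abbrev R3 : Type := EuclideanSpace ℝ (Fin 3)

/-- The standard basis vectors. -/
def stdVec (i : Fin 3) : R3 := EuclideanSpace.single i 1

/-- The partial derivative `∂ᵢ Xʲ`. -/
def pd (i j : Fin 3) (X : R3 → R3) (x : R3) : ℝ := fderiv ℝ X x (stdVec i) j

/-- Divergence. -/
def divergence (X : R3 → R3) (x : R3) : ℝ := ∑ i, pd i i X x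

/-- Curl. -/
def curl (X : R3 → R3) (x : R3) : R3 :=
  !₂[pd 1 2 X x - pd 2 1 X x, pd 2 0 X x - pd 0 2 X x, pd 0 1 X x - pd 1 0 X x]

/-- The cross product of vector fields. -/
def cross (X Y : R3 → R3) (x : R3) : R3 :=
  !₂[X x 1 * Y x 2 - X x 2 * Y x 1, X x 2 * Y x 0 - X x 0 * Y x 2,
    X x 0 * Y x 1 - X x 1 * Y x 0]

/-- The `1`-form `X^♭` dual to a vector field `X`. -/
def flat (X : R3 → R3) : R3 → R3 [⋀^Fin 1]→L[ℝ] ℝ :=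
  fun x => ContinuousAlternatingMap.ofSubsingleton ℝ R3 ℝ (0 : Fin 1) (innerSL ℝ (X x))

/-- The volume form `ν = dx ∧ dy ∧ dz`, as an alternating map. -/
def vol : R3 [⋀^Fin 3]→L[ℝ] ℝ :=
  { (EuclideanSpace.basisFun (Fin 3) ℝ).toBasis.det with
    cont := by
      change Continuous fun v : Fin 3 → R3 => (EuclideanSpace.basisFun (Fin 3) ℝ).toBasis.det v
      simp only [Module.Basis.det_apply]
      refine Continuous.matrix_det (continuous_matrix fun i j => ?_)
      simp only [Module.Basis.toMatrix_apply, OrthonormalBasis.coe_toBasis_repr_apply,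
        EuclideanSpace.basisFun_repr]
      fun_prop }

/-- The volume form `ν` as a (constant) differential form. -/
def nu : R3 → R3 [⋀^Fin 3]→L[ℝ] ℝ := fun _ => vol

/-- The codifferential `δ` of the Euclidean metric:
`(δα)(w₁, …, wₖ) = -∑ᵢ (∂ᵢ α)(eᵢ, w₁, …, wₖ)`. -/
def codiff {k : ℕ} (α : R3 → R3 [⋀^Fin (k + 1)]→L[ℝ] ℝ) : R3 → R3 [⋀^Fin k]→L[ℝ] ℝ :=
  fun x => -∑ i, (fderiv ℝ α x (stdVec i)).curryLeft (stdVec i)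

/-- `u = Δ⁻¹ φ` for `0`-forms: `u` is smooth, vanishes at infinity and `Δ u = φ`, where
`Δ = dδ + δd = δd` is the Riemannian (nonnegative) Laplacian. -/
structure IsInvLaplacian (φ u : R3 → R3 [⋀^Fin 0]→L[ℝ] ℝ) : Prop where
  smooth : ContDiff ℝ ∞ u
  poisson : codiff (extDeriv u) = φ
  decay : Filter.Tendsto u (Filter.cocompact R3) (𝓝 0)

/-- `B` is a vector potential of `b`. -/
structure IsVectorPotential (b B : R3 → R3) : Prop where
  smooth : ContDiff ℝ ∞ B
  curl_eq : curl B = b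

/-- `B` is the vector potential of `b` in Coulomb gauge, vanishing at infinity. -/
structure IsCoulombPotential (b B : R3 → R3) : Prop extends IsVectorPotential b B where
  div_eq : divergence B = 0
  decay : Filter.Tendsto B (Filter.cocompact R3) (𝓝 0)

/-! ## The Lie algebra of rapidly decreasing divergence-free vector fields -/

/-- The commutator `(X·∇)Y - (Y·∇)X` of Schwartz vector fields. -/
def schwartzBracket (X Y : 𝓢(R3, R3)) : 𝓢(R3, R3) :=
  SchwartzMap.pairing (ContinuousLinearMap.id ℝ (R3 →L[ℝ] R3))
      (SchwartzMap.fderivCLM ℝ R3 R3 Y) X -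
    SchwartzMap.pairing (ContinuousLinearMap.id ℝ (R3 →L[ℝ] R3))
      (SchwartzMap.fderivCLM ℝ R3 R3 X) Y

theorem schwartzBracket_coe (X Y : 𝓢(R3, R3)) :
    ⇑(schwartzBracket X Y) = VectorField.lieBracket ℝ X Y := by
  ext x
  simp [schwartzBracket, VectorField.lieBracket_eq]

instance : LieRing 𝓢(R3, R3) where
  bracket := schwartzBracket
  add_lie X Y Z := by
    refine DFunLike.coe_injective (funext fun x => ?_)
    change schwartzBracket (X + Y) Z x = (schwartzBracket X Z + schwartzBracket Y Z) x
    rw [add_apply]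
    simp only [schwartzBracket_coe]
    exact VectorField.lieBracket_add_left X.differentiableAt Y.differentiableAt
  lie_add X Y Z := by
    refine DFunLike.coe_injective (funext fun x => ?_)
    change schwartzBracket X (Y + Z) x = (schwartzBracket X Y + schwartzBracket X Z) x
    rw [add_apply]
    simp only [schwartzBracket_coe]
    exact VectorField.lieBracket_add_right Y.differentiableAt Z.differentiableAt
  lie_self X := by
    refine DFunLike.coe_injective ?_
    rw [schwartzBracket_coe, VectorField.lieBracket_self]
    rfl
  leibniz_lie X Y Z := by
    refine DFunLike.coe_injective (funext fun x => ?_)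
    change schwartzBracket X (schwartzBracket Y Z) x =
      (schwartzBracket (schwartzBracket X Y) Z + schwartzBracket Y (schwartzBracket X Z)) x
    rw [add_apply]
    simp only [schwartzBracket_coe]
    have h : minSmoothness ℝ 2 ≤ (2 : ℕ∞) := by simp
    exact VectorField.leibniz_identity_lieBracket h (X.smooth 2).contDiffAt
      (Y.smooth 2).contDiffAt (Z.smooth 2).contDiffAt

theorem lie_coe (X Y : 𝓢(R3, R3)) : ⇑⁅X, Y⁆ = VectorField.lieBracket ℝ X Y :=
  schwartzBracket_coe X Y

instance : LieAlgebra ℝ 𝓢(R3, R3) where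
  lie_smul c X Y := by
    refine DFunLike.coe_injective (funext fun x => ?_)
    rw [smul_apply]
    simp only [lie_coe]
    exact VectorField.lieBracket_const_smul_right Y.differentiableAt

theorem pd_add (i j : Fin 3) (X Y : 𝓢(R3, R3)) (x : R3) :
    pd i j (X + Y : 𝓢(R3, R3)) x = pd i j X x + pd i j Y x := by
  have h : fderiv ℝ (⇑(X + Y)) x = fderiv ℝ X x + fderiv ℝ Y x :=
    fderiv_add X.differentiableAt Y.differentiableAt
  unfold pd
  rw [h]
  rfl

theorem pd_smul (i j : Fin 3) (c : ℝ) (X : 𝓢(R3, R3)) (x : R3) :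
    pd i j (c • X : 𝓢(R3, R3)) x = c * pd i j X x := by
  have h : fderiv ℝ (⇑(c • X)) x = c • fderiv ℝ X x :=
    fderiv_const_smul X.differentiableAt c
  unfold pd
  rw [h]
  rfl

theorem fderiv_lieBracket_apply (X Y : 𝓢(R3, R3)) (x v : R3) :
    fderiv ℝ ⇑⁅X, Y⁆ x v =
      (fderiv ℝ (fderiv ℝ Y) x v (X x) + fderiv ℝ Y x (fderiv ℝ X x v)) -
        (fderiv ℝ (fderiv ℝ X) x v (Y x) + fderiv ℝ X x (fderiv ℝ Y x v)) := by
  have hd : ∀ Z : 𝓢(R3, R3), DifferentiableAt ℝ (fderiv ℝ Z) x := fun Z =>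
    ((Z.smooth 2).fderiv_right (m := 1) (by norm_num)).differentiable (by norm_num) x
  have h1 : ∀ Z W : 𝓢(R3, R3), HasFDerivAt (fun y => fderiv ℝ Z y (W y))
      ((fderiv ℝ Z x).comp (fderiv ℝ W x) + (fderiv ℝ (fderiv ℝ Z) x).flip (W x)) x :=
    fun Z W => (hd Z).hasFDerivAt.clm_apply W.differentiableAt.hasFDerivAt
  have h2 : ⇑⁅X, Y⁆ = (fun y => fderiv ℝ Y y (X y)) - fun y => fderiv ℝ X y (Y y) := lie_coe X Y
  rw [h2, ((h1 Y X).sub (h1 X Y)).fderiv]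
  simp only [sub_apply, add_apply, ContinuousLinearMap.comp_apply, ContinuousLinearMap.flip_apply]
  abel

theorem sum_second_fderiv (X : 𝓢(R3, R3)) (hX : divergence X = 0) (x w : R3) :
    ∑ i, fderiv ℝ (fderiv ℝ X) x (stdVec i) w i = 0 := by
  have hd : DifferentiableAt ℝ (fderiv ℝ X) x :=
    ((X.smooth 2).fderiv_right (m := 1) (by norm_num)).differentiable (by norm_num) x
  have hs : ∀ v, fderiv ℝ (fderiv ℝ X) x v w = fderiv ℝ (fderiv ℝ X) x w v := fun v =>
    ((X.smooth 2).contDiffAt.isSymmSndFDerivAt (by simp)).eq v w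
  let T : (R3 →L[ℝ] R3) →L[ℝ] ℝ :=
    ∑ i, (EuclideanSpace.proj i).comp (ContinuousLinearMap.apply ℝ R3 (stdVec i))
  have hT : ∀ A : R3 →L[ℝ] R3, T A = ∑ i, A (stdVec i) i := fun A => by
    simp [T]
  have h0 : (fun y => T (fderiv ℝ X y)) = fun _ => 0 := by
    funext y
    rw [hT]
    exact congrFun hX y
  have h1 : HasFDerivAt (fun y => T (fderiv ℝ X y)) (T.comp (fderiv ℝ (fderiv ℝ X) x)) x :=
    T.hasFDerivAt.comp x hd.hasFDerivAt
  rw [h0] at h1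
  have h2 := h1.unique (hasFDerivAt_const (0 : ℝ) x)
  have h3 : T (fderiv ℝ (fderiv ℝ X) x w) = 0 := by
    simpa using congrArg (fun A : R3 →L[ℝ] ℝ => A w) h2
  simp only [hs]
  rw [← hT, h3]

theorem divergence_lieBracket (X Y : 𝓢(R3, R3)) (hX : divergence X = 0)
    (hY : divergence Y = 0) : divergence ⇑⁅X, Y⁆ = 0 := by
  funext x
  have ht : ∑ i, fderiv ℝ Y x (fderiv ℝ X x (stdVec i)) i =
      ∑ i, fderiv ℝ X x (fderiv ℝ Y x (stdVec i)) i := by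
    have h := LinearMap.trace_mul_comm ℝ (fderiv ℝ Y x : R3 →ₗ[ℝ] R3) (fderiv ℝ X x : R3 →ₗ[ℝ] R3)
    rw [LinearMap.trace_eq_sum_inner _ (EuclideanSpace.basisFun (Fin 3) ℝ),
      LinearMap.trace_eq_sum_inner _ (EuclideanSpace.basisFun (Fin 3) ℝ)] at h
    simpa [stdVec, EuclideanSpace.inner_single_left] using h
  have h1 := sum_second_fderiv X hX x (Y x)
  have h2 := sum_second_fderiv Y hY x (X x)
  simp only [divergence, pd, fderiv_lieBracket_apply, PiLp.sub_apply, PiLp.add_apply,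
    Finset.sum_sub_distrib, Finset.sum_add_distrib, h1, h2, ht]
  simp

/-- The Lie algebra `𝔤` of rapidly decreasing divergence-free vector fields on `ℝ³`, with the
commutator bracket `[X, Y] = (X·∇)Y - (Y·∇)X`. -/
def divFree : LieSubalgebra ℝ 𝓢(R3, R3) where
  carrier := {X | divergence X = 0}
  add_mem' {X Y} hX hY := by
    funext x
    have h1 : divergence X x = 0 := congrFun hX x
    have h2 : divergence Y x = 0 := congrFun hY x
    simp only [divergence] at h1 h2
    simp only [divergence, pd_add, Finset.sum_add_distrib, h1, h2]
    simp
  zero_mem' := by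
    funext x
    have h : (⇑(0 : 𝓢(R3, R3))) = fun _ => 0 := rfl
    simp [divergence, pd, h]
  smul_mem' c X hX := by
    funext x
    have h1 : divergence X x = 0 := congrFun hX x
    simp only [divergence] at h1
    simp only [divergence, pd_smul, ← Finset.mul_sum, h1]
    simp
  lie_mem' {X Y} hX hY := divergence_lieBracket X Y hX hY

/-- The tautological infinitesimal action of `𝔤` on `ℝ³`: the fundamental vector field of `b` is
`b` itself. -/
def fundField : divFree →ₗ[ℝ] (R3 → R3) where
  toFun b := (b : 𝓢(R3, R3))
  map_add' _ _ := rfl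
  map_smul' _ _ := rfl

/-- `μ₂(b, c) = f₁([b, c]) - ι(b ∧ c) ν`, where `ι(b ∧ c) ν = ν(b, c, ⋅)`. -/
def muTwo (f₁ : divFree →ₗ[ℝ] SmoothForm R3 1) (b c : divFree) : R3 → R3 [⋀^Fin 1]→L[ℝ] ℝ :=
  (f₁ ⁅b, c⁆ : R3 → R3 [⋀^Fin 1]→L[ℝ] ℝ) - iprod (fundField c) (iprod (fundField b) nu)

/-! ## Loops, oriented knots and the Brylinski space -/

/-- Smooth loops `S¹ = ℝ/ℤ → ℝ³`. -/
structure Loop where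
  toFun : ℝ → R3
  smooth : ContDiff ℝ ∞ toFun
  periodic : Function.Periodic toFun 1

instance : CoeFun Loop (fun _ => ℝ → R3) := ⟨Loop.toFun⟩

/-- Parametrized oriented knots: smooth embeddings `S¹ = ℝ/ℤ → ℝ³`. -/
structure Knot extends Loop where
  immersed : ∀ t, deriv toFun t ≠ 0
  injective : ∀ s t, toFun s = toFun t → ∃ n : ℤ, t = s + n

instance : CoeFun Knot (fun _ => ℝ → R3) := ⟨fun K => K.toFun⟩

/-- Orientation-preserving diffeomorphisms of `S¹ = ℝ/ℤ`, lifted to `ℝ`. -/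
structure Reparam where
  toFun : ℝ → ℝ
  invFun : ℝ → ℝ
  smooth : ContDiff ℝ ∞ toFun
  smooth_inv : ContDiff ℝ ∞ invFun
  left_inv : Function.LeftInverse invFun toFun
  right_inv : Function.RightInverse invFun toFun
  mono : StrictMono toFun
  shift : ∀ t, toFun (t + 1) = toFun t + 1

/-- Two parametrized knots define the same oriented knot if they differ by an
orientation-preserving reparametrization. -/
instance knotSetoid : Setoid Knot where
  r K K' := ∃ φ : Reparam, ∀ t, K' t = K (φ.toFun t)
  iseqv := by
    refine ⟨fun K => ⟨⟨id, id, contDiff_id, contDiff_id, fun _ => rfl, fun _ => rfl,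
      strictMono_id, fun _ => rfl⟩, fun _ => rfl⟩, ?_, ?_⟩
    · rintro K K' ⟨φ, h⟩
      refine ⟨⟨φ.invFun, φ.toFun, φ.smooth_inv, φ.smooth, φ.right_inv, φ.left_inv, ?_, ?_⟩, ?_⟩
      · intro s t hst
        rw [← φ.mono.lt_iff_lt, φ.right_inv, φ.right_inv]
        exact hst
      · intro t
        apply φ.mono.injective
        rw [φ.right_inv, φ.shift, φ.right_inv]
      · intro t
        rw [h, φ.right_inv]
    · rintro K K' K'' ⟨φ, h⟩ ⟨ψ, h'⟩
      refine ⟨⟨φ.toFun ∘ ψ.toFun, ψ.invFun ∘ φ.invFun, φ.smooth.comp ψ.smooth,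
        ψ.smooth_inv.comp φ.smooth_inv, φ.left_inv.comp ψ.left_inv,
        φ.right_inv.comp ψ.right_inv, φ.mono.comp ψ.mono, ?_⟩, ?_⟩
      · intro t
        simp [ψ.shift, φ.shift]
      · intro t
        rw [h', h]
        rfl

/-- The Brylinski space `Y` of oriented knots. -/
def Brylinski : Type := Quotient knotSetoid

/-- The oriented knot underlying a parametrized knot. -/
def Knot.mk' (K : Knot) : Brylinski := Quotient.mk knotSetoid K

/-- The circulation `∮_γ B`. -/
def circulation (B : R3 → R3) (γ : ℝ → R3) : ℝ :=
  ∫ t in (0 : ℝ)..1, inner ℝ (B (γ t)) (deriv γ t)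

/-- The `2`-form `Ω_γ(u, v) = ∫₀¹ ν(γ', u, v) dt`, the transgression of `ν`; on knots it
represents the symplectic form `Ω_Y`, a tangent vector to `Y` being represented by a vector field
along a parametrized knot. -/
def Omega (γ u v : ℝ → R3) : ℝ := transgress nu γ ![u, v]

/-- `Ω` induces a weakly nondegenerate form on `Y`: it is invariant under reparametrization and
its kernel at a knot consists exactly of the tangential vector fields. -/
structure OmegaDescends : Prop where
  invariant : ∀ (K : Knot) (φ : Reparam) (u v : Loop),
    Omega (fun t => K (φ.toFun t)) (fun t => u (φ.toFun t)) (fun t => v (φ.toFun t)) = Omega K u v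
  kernel : ∀ (K : Knot) (u : Loop),
    (∀ v : Loop, Omega K u v = 0) ↔ ∃ h : ℝ → ℝ, ∀ t, u t = h t • deriv K.toFun t

/-- `μ : 𝔤 → C^∞(Y)` is a co-momentum map for the action of `𝔤` on `(Y, Ω_Y)`: the vector field
`K ↦ b ∘ K` is a Hamiltonian vector field of `μ_b`, i.e. `dμ_b + ι_b Ω_Y = 0` (tested on all smooth
variations of knots), and `{μ_b, μ_c} := Ω_Y(b, c) = μ_{[b, c]}`. -/
structure IsBrylinskiComomentumMap (μ : divFree →ₗ[ℝ] (Brylinski → ℝ)) : Prop where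
  hamiltonian : ∀ (b : divFree) (Γ : ℝ → Knot) (u : ℝ → R3),
    ContDiff ℝ ∞ (fun p : ℝ × ℝ => Γ p.1 p.2) →
    (∀ t, HasDerivAt (fun s => Γ s t) (u t) 0) →
    HasDerivAt (fun s => μ b (Γ s).mk') (-Omega (Γ 0) (fun t => fundField b (Γ 0 t)) u) 0
  bracket : ∀ (b c : divFree) (K : Knot),
    Omega K (fun t => fundField b (K t)) (fun t => fundField c (K t)) = μ ⁅b, c⁆ K.mk'

end Hydro

end

open Hydro

/-! The Euclidean structure turns every form into a vector field or a function: `d` on functions is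
the gradient, `d X^♭ = ι_{curl X} ν`, `ι_Y ι_X ν = (X × Y)^♭`, and `δ X^♭ = -div X`. The equation
for `f₁` then says `curl B = b`, and `μ₂(b, c)` is minus the flat of the Coulomb potential of `[b,
c]` plus `b × c`.

Two analytic facts carry everything. Existence (`exists_poisson`): for Schwartz data the Poisson
equation is solved by dividing the Fourier transform by `4π²|ξ|²`, which is integrable near the
origin in dimension 3; by Riemann–Lebesgue the solution and its first derivatives vanish at
infinity. Uniqueness (`eq_zero_of_lap_eq_zero`): a harmonic function vanishing at infinity is zero,
by the maximum principle. Hence a field that is curl-free, divergence-free and vanishing at infinity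
is zero, so Coulomb potentials are unique and linear in `b`.

Since `curl (b × c) = [c, b]`, the form `μ₂(b, c)` is closed. With `h = Δ⁻¹ δ μ₂`, the difference
`dh - μ₂` is closed, coclosed and vanishes at infinity, hence is zero (`grad_bracketPotential`). So
`d f₂ = μ₂`, which is both the equation for `k = 2` and (iii). For `k = 3` the two sides vanish at
infinity and have equal gradients, by the Jacobi identity and the formula for `d(ν(b, c, e))`
(`bracketPotential_boundary`).

On loops, a curl-free field is a gradient and has no circulation, so any potential may be used; in
particular `-b × c` for `[b, c]`, which gives the bracket identity. The first variation of a
circulation is an integration by parts (`hasDerivAt_circulation`). Equivariance fails because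
Cartan's formula gives `L_b f₁(b) = -d(B · b)`, and the helicity density `B · b` need not be
constant. -/

noncomputable section

namespace Hydro

/-! ## Partial derivatives of functions on `ℝ³` -/

/-- The partial derivative `∂ᵢ f` of a scalar function. -/
def partialDeriv (i : Fin 3) (f : R3 → ℝ) (x : R3) : ℝ := fderiv ℝ f x (stdVec i)

/-- The gradient of a scalar function. -/
def grad (f : R3 → ℝ) (x : R3) : R3 :=
  !₂[partialDeriv 0 f x, partialDeriv 1 f x, partialDeriv 2 f x]

/-- The analyst's Laplacian `∑ᵢ ∂ᵢ²`. -/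
def lap (f : R3 → ℝ) (x : R3) : ℝ := ∑ i, partialDeriv i (partialDeriv i f) x

theorem sum_smul_stdVec (v : R3) : ∑ i, v i • stdVec i = v := by
  ext j
  simp [stdVec, Fin.sum_univ_three]
  fin_cases j <;> simp

theorem contDiff_coord {X : R3 → R3} (hX : ContDiff ℝ ∞ X) (i : Fin 3) :
    ContDiff ℝ ∞ fun x => X x i :=
  contDiff_euclidean.1 hX i

theorem differentiable_coord {X : R3 → R3} (hX : ContDiff ℝ ∞ X) (i : Fin 3) :
    Differentiable ℝ fun x => X x i :=
  (contDiff_coord hX i).differentiable (by simp)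

theorem contDiff_vec {f g h : R3 → ℝ} (hf : ContDiff ℝ ∞ f) (hg : ContDiff ℝ ∞ g)
    (hh : ContDiff ℝ ∞ h) : ContDiff ℝ ∞ fun x => (!₂[f x, g x, h x] : R3) := by
  rw [contDiff_euclidean]
  intro i
  fin_cases i <;> simpa

theorem contDiff_partialDeriv {f : R3 → ℝ} (hf : ContDiff ℝ ∞ f) (i : Fin 3) :
    ContDiff ℝ ∞ (partialDeriv i f) :=
  (hf.fderiv_right (m := ∞) (by simp)).clm_apply contDiff_const

theorem pd_eq_partialDeriv {X : R3 → R3} {x : R3} (hX : DifferentiableAt ℝ X x) (i j : Fin 3) :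
    pd i j X x = partialDeriv i (fun y => X y j) x := by
  have h : HasFDerivAt (fun y => X y j) ((EuclideanSpace.proj j).comp (fderiv ℝ X x)) x :=
    (EuclideanSpace.proj (𝕜 := ℝ) j).hasFDerivAt.comp x hX.hasFDerivAt
  rw [partialDeriv, h.fderiv]
  rfl

theorem contDiff_pd {X : R3 → R3} (hX : ContDiff ℝ ∞ X) (i j : Fin 3) :
    ContDiff ℝ ∞ (pd i j X) := by
  have h : pd i j X = partialDeriv i fun y => X y j :=
    funext fun x => pd_eq_partialDeriv (hX.differentiable (by simp) x) i j
  rw [h]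
  exact contDiff_partialDeriv (contDiff_coord hX j) i

theorem contDiff_curl {X : R3 → R3} (hX : ContDiff ℝ ∞ X) : ContDiff ℝ ∞ (curl X) :=
  contDiff_vec ((contDiff_pd hX _ _).sub (contDiff_pd hX _ _))
    ((contDiff_pd hX _ _).sub (contDiff_pd hX _ _)) ((contDiff_pd hX _ _).sub (contDiff_pd hX _ _))

theorem contDiff_grad {f : R3 → ℝ} (hf : ContDiff ℝ ∞ f) : ContDiff ℝ ∞ (grad f) :=
  contDiff_vec (contDiff_partialDeriv hf _) (contDiff_partialDeriv hf _)
    (contDiff_partialDeriv hf _)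

theorem contDiff_cross {X Y : R3 → R3} (hX : ContDiff ℝ ∞ X) (hY : ContDiff ℝ ∞ Y) :
    ContDiff ℝ ∞ (cross X Y) :=
  have h i j := (contDiff_coord hX i).mul (contDiff_coord hY j)
  contDiff_vec ((h _ _).sub (h _ _)) ((h _ _).sub (h _ _)) ((h _ _).sub (h _ _))

theorem partialDeriv_comm {f : R3 → ℝ} (hf : ContDiff ℝ ∞ f) (i j : Fin 3) :
    partialDeriv i (partialDeriv j f) = partialDeriv j (partialDeriv i f) := by
  funext x
  have hd : DifferentiableAt ℝ (fderiv ℝ f) x :=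
    (hf.fderiv_right (m := ∞) (by simp)).differentiable (by simp) x
  have h (k l : Fin 3) : partialDeriv k (partialDeriv l f) x =
      fderiv ℝ (fderiv ℝ f) x (stdVec k) (stdVec l) := by
    have := (hd.hasFDerivAt.clm_apply (hasFDerivAt_const (stdVec l) x)).fderiv
    unfold partialDeriv
    rw [this]
    simp
  rw [h, h]
  exact ((contDiff_infty.1 hf 2).contDiffAt.isSymmSndFDerivAt (by simp)).eq _ _

theorem partialDeriv_add {f g : R3 → ℝ} (hf : Differentiable ℝ f) (hg : Differentiable ℝ g)
    (i : Fin 3) :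
    partialDeriv i (fun x => f x + g x) = fun x => partialDeriv i f x + partialDeriv i g x := by
  funext x
  simp [partialDeriv, fderiv_fun_add (hf x) (hg x)]

theorem partialDeriv_sub {f g : R3 → ℝ} (hf : Differentiable ℝ f) (hg : Differentiable ℝ g)
    (i : Fin 3) :
    partialDeriv i (fun x => f x - g x) = fun x => partialDeriv i f x - partialDeriv i g x := by
  funext x
  simp [partialDeriv, fderiv_fun_sub (hf x) (hg x)]

theorem partialDeriv_mul {f g : R3 → ℝ} (hf : Differentiable ℝ f) (hg : Differentiable ℝ g)
    (i : Fin 3) :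
    partialDeriv i (fun x => f x * g x) =
      fun x => f x * partialDeriv i g x + g x * partialDeriv i f x := by
  funext x
  simp [partialDeriv, fderiv_fun_mul (hf x) (hg x)]

theorem partialDeriv_neg (f : R3 → ℝ) (i : Fin 3) :
    partialDeriv i (fun x => -f x) = fun x => -partialDeriv i f x := by
  funext x
  simp [partialDeriv]

theorem fderiv_apply_coord (X : R3 → R3) (x v : R3) (j : Fin 3) :
    fderiv ℝ X x v j = ∑ i, v i * pd i j X x := by
  conv_lhs => rw [← sum_smul_stdVec v]
  simp [pd]

theorem fderiv_apply_eq_inner_grad (f : R3 → ℝ) (x v : R3) :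
    fderiv ℝ f x v = inner ℝ (grad f x) v := by
  conv_lhs => rw [← sum_smul_stdVec v]
  simp [grad, partialDeriv, PiLp.inner_apply, Fin.sum_univ_three]

/-! ## Differential forms and vector calculus -/

theorem flat_apply (X : R3 → R3) (x : R3) (w : Fin 1 → R3) :
    flat X x w = inner ℝ (X x) (w 0) := rfl

theorem inner_R3 (v w : R3) : inner ℝ v w = v 0 * w 0 + v 1 * w 1 + v 2 * w 2 := by
  simp [PiLp.inner_apply, Fin.sum_univ_three, mul_comm]

theorem vol_apply (v : Fin 3 → R3) :
    vol v = v 0 0 * (v 1 1 * v 2 2 - v 1 2 * v 2 1) + v 0 1 * (v 1 2 * v 2 0 - v 1 0 * v 2 2) +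
      v 0 2 * (v 1 0 * v 2 1 - v 1 1 * v 2 0) := by
  change (EuclideanSpace.basisFun (Fin 3) ℝ).toBasis.det v = _
  rw [Module.Basis.det_apply, Matrix.det_fin_three]
  simp [Module.Basis.toMatrix_apply]
  ring


theorem flat_eq_comp (X : R3 → R3) :
    flat X = fun x => ContinuousAlternatingMap.ofSubsingletonLIE (𝕜 := ℝ) (E := R3) (F := ℝ) (0 : Fin 1)
      (innerSL ℝ (X x)) := rfl

theorem contDiff_flat {X : R3 → R3} (hX : ContDiff ℝ ∞ X) : ContDiff ℝ ∞ (flat X) := by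
  rw [flat_eq_comp]
  exact (LinearIsometryEquiv.contDiff _).comp ((innerSL ℝ).contDiff.comp hX)

theorem flat_injective : Function.Injective flat := by
  intro X Y h
  funext x
  refine ext_inner_right ℝ fun w => ?_
  exact congrArg (fun α : R3 [⋀^Fin 1]→L[ℝ] ℝ => α fun _ => w) (congrFun h x)

theorem flat_add (X Y : R3 → R3) : flat (X + Y) = flat X + flat Y := by
  funext x
  ext w
  simp [flat_apply, inner_add_left]

theorem flat_neg (X : R3 → R3) : flat (-X) = -flat X := by
  funext x
  ext w
  simp [flat_apply]

theorem flat_smul (c : ℝ) (X : R3 → R3) : flat (c • X) = c • flat X := by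
  funext x
  ext w
  simp [flat_apply, inner_smul_left]

theorem fderiv_flat_apply {X : R3 → R3} {x : R3} (hX : DifferentiableAt ℝ X x) (v : R3)
    (w : Fin 1 → R3) : fderiv ℝ (flat X) x v w = inner ℝ (fderiv ℝ X x v) (w 0) := by
  have h : HasFDerivAt (flat X) _ x :=
    (ContinuousAlternatingMap.ofSubsingletonLIE (𝕜 := ℝ) (E := R3) (F := ℝ)
      (0 : Fin 1)).toContinuousLinearEquiv.hasFDerivAt.comp x
      ((innerSL ℝ).hasFDerivAt.comp x hX.hasFDerivAt)
  rw [h.fderiv]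
  rfl

/-- The `0`-form given by a function. -/
def zeroForm (h : R3 → ℝ) : R3 → R3 [⋀^Fin 0]→L[ℝ] ℝ :=
  fun x => ContinuousAlternatingMap.constOfIsEmptyLIE ℝ R3 ℝ (Fin 0) (h x)

theorem zeroForm_apply (h : R3 → ℝ) (x : R3) (w : Fin 0 → R3) : zeroForm h x w = h x := rfl

theorem zeroForm_injective : Function.Injective zeroForm := fun _ _ h =>
  funext fun x => (ContinuousAlternatingMap.constOfIsEmptyLIE ℝ R3 ℝ (Fin 0)).injective
    (congrFun h x)

theorem zeroForm_surjective : Function.Surjective zeroForm := fun u =>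
  ⟨fun x => (ContinuousAlternatingMap.constOfIsEmptyLIE ℝ R3 ℝ (Fin 0)).symm (u x),
    funext fun _ => LinearIsometryEquiv.apply_symm_apply _ _⟩

theorem contDiff_zeroForm_iff {h : R3 → ℝ} : ContDiff ℝ ∞ (zeroForm h) ↔ ContDiff ℝ ∞ h :=
  (ContinuousAlternatingMap.constOfIsEmptyLIE ℝ R3 ℝ
    (Fin 0)).toContinuousLinearEquiv.comp_contDiff_iff

theorem tendsto_zeroForm_iff {h : R3 → ℝ} {l : Filter R3} :
    Filter.Tendsto (zeroForm h) l (𝓝 0) ↔ Filter.Tendsto h l (𝓝 0) := by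
  rw [tendsto_zero_iff_norm_tendsto_zero, tendsto_zero_iff_norm_tendsto_zero (f := h)]
  simp [zeroForm]

theorem extDeriv_zeroForm (h : R3 → ℝ) : extDeriv (zeroForm h) = flat (grad h) := by
  funext x
  ext w
  refine (congrArg (fun α : R3 [⋀^Fin 1]→L[ℝ] ℝ => α w) (extDeriv_constOfIsEmpty h x)).trans ?_
  exact fderiv_apply_eq_inner_grad h x (w 0)

theorem iprod_nu_apply (X : R3 → R3) (x : R3) (w : Fin 2 → R3) :
    iprod X nu x w = vol (Matrix.vecCons (X x) w) := rfl

/-- Both sides antisymmetrize the Jacobian of `X`: the differences `∂ᵢXʲ - ∂ⱼXⁱ` are the components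
of the curl. -/
theorem extDeriv_flat {X : R3 → R3} (hX : Differentiable ℝ X) :
    extDeriv (flat X) = iprod (curl X) nu := by
  funext x
  ext w
  rw [extDeriv, ContinuousAlternatingMap.alternatizeUncurryFin_apply, iprod_nu_apply, vol_apply]
  simp only [fderiv_flat_apply (hX x), inner_R3, fderiv_apply_coord,
    Fin.sum_univ_three]
  simp [curl, Fin.removeNth]
  ring

theorem iprod_iprod_nu (X Y : R3 → R3) : iprod Y (iprod X nu) = flat (cross X Y) := by
  funext x
  ext w
  change vol ![X x, Y x, w 0] = inner ℝ (cross X Y x) (w 0)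
  rw [vol_apply, inner_R3]
  simp [cross]
  ring

theorem iprod_flat (X Y : R3 → R3) : iprod Y (flat X) = zeroForm fun x => inner ℝ (X x) (Y x) :=
  rfl

theorem codiff_flat {X : R3 → R3} (hX : Differentiable ℝ X) :
    codiff (flat X) = zeroForm (-divergence X) := by
  funext x
  ext w
  simp only [codiff, zeroForm_apply, divergence, Pi.neg_apply]
  simp [fderiv_flat_apply (hX x), inner_R3, Fin.sum_univ_three, stdVec, pd]

theorem codiff_extDeriv_zeroForm {h : R3 → ℝ} (hh : ContDiff ℝ ∞ h) :
    codiff (extDeriv (zeroForm h)) = zeroForm (-lap h) := by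
  have hg := (contDiff_grad hh).differentiable (by simp)
  rw [extDeriv_zeroForm, codiff_flat hg]
  congr 2
  funext x
  simp only [divergence, lap, pd_eq_partialDeriv (hg x), Fin.sum_univ_three]
  rfl

theorem isTwoPlectic_nu : IsTwoPlectic nu where
  smooth := contDiff_const
  closed := by
    funext x
    have h : fderiv ℝ nu x = 0 := fderiv_const_apply vol
    rw [extDeriv, h]
    exact map_zero (ContinuousAlternatingMap.alternatizeUncurryFinCLM ℝ R3 ℝ)
  injective X Y _ _ h := by
    funext x
    have h' (Z W : R3 → R3) : cross X Z x = cross Y Z x :=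
      congrFun (flat_injective (by rw [← iprod_iprod_nu, ← iprod_iprod_nu, h])) x
    -- `X × e₀` determines the components 1 and 2 of `X`, and `X × e₁` supplies component 0.
    have h0 := h' (fun _ => stdVec 0) 0
    have h1 := h' (fun _ => stdVec 1) 0
    have a := congrArg (fun v : R3 => v 1) h0
    have b := congrArg (fun v : R3 => v 2) h0
    have c := congrArg (fun v : R3 => v 2) h1
    simp [cross, stdVec] at a b c
    ext i
    fin_cases i
    exacts [c, b, a]

/-! ## Identities of vector calculus -/

theorem curl_eq {X : R3 → R3} (hX : Differentiable ℝ X) : curl X = fun x =>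
    !₂[partialDeriv 1 (fun y => X y 2) x - partialDeriv 2 (fun y => X y 1) x,
      partialDeriv 2 (fun y => X y 0) x - partialDeriv 0 (fun y => X y 2) x,
      partialDeriv 0 (fun y => X y 1) x - partialDeriv 1 (fun y => X y 0) x] := by
  funext x
  simp only [curl, pd_eq_partialDeriv (hX x)]

theorem divergence_eq {X : R3 → R3} (hX : Differentiable ℝ X) : divergence X = fun x =>
    partialDeriv 0 (fun y => X y 0) x + partialDeriv 1 (fun y => X y 1) x +
      partialDeriv 2 (fun y => X y 2) x := by
  funext x
  simp only [divergence, pd_eq_partialDeriv (hX x), Fin.sum_univ_three]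

theorem curl_add {X Y : R3 → R3} (hX : Differentiable ℝ X) (hY : Differentiable ℝ Y) :
    curl (X + Y) = curl X + curl Y := by
  funext x
  ext i
  have h (i j : Fin 3) : pd i j (X + Y) x = pd i j X x + pd i j Y x := by
    simp [pd, fderiv_add (hX x) (hY x)]
  fin_cases i <;> simp [curl, h] <;> ring

theorem curl_smul (c : ℝ) (X : R3 → R3) : curl (c • X) = c • curl X := by
  funext x
  ext i
  have h (i j : Fin 3) : pd i j (c • X) x = c * pd i j X x := by
    simp [pd, fderiv_const_smul_field]
  fin_cases i <;> simp [curl, h] <;> ring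

theorem divergence_add {X Y : R3 → R3} (hX : Differentiable ℝ X) (hY : Differentiable ℝ Y) :
    divergence (X + Y) = divergence X + divergence Y := by
  funext x
  simp [divergence, pd, fderiv_add (hX x) (hY x), Finset.sum_add_distrib]

theorem divergence_smul (c : ℝ) (X : R3 → R3) : divergence (c • X) = c • divergence X := by
  funext x
  simp [divergence, pd, fderiv_const_smul_field, Finset.mul_sum]

theorem curl_grad {f : R3 → ℝ} (hf : ContDiff ℝ ∞ f) : curl (grad f) = 0 := by
  rw [curl_eq ((contDiff_grad hf).differentiable (by simp))]
  funext x
  ext i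
  have h (i j : Fin 3) := congrFun (partialDeriv_comm hf i j) x
  fin_cases i
  · exact sub_eq_zero.2 (h 1 2)
  · exact sub_eq_zero.2 (h 2 0)
  · exact sub_eq_zero.2 (h 0 1)

theorem divergence_curl {X : R3 → R3} (hX : ContDiff ℝ ∞ X) : divergence (curl X) = 0 := by
  rw [divergence_eq ((contDiff_curl hX).differentiable (by simp)),
    curl_eq (hX.differentiable (by simp))]
  funext x
  have hd (i j : Fin 3) : Differentiable ℝ (partialDeriv i fun y => X y j) :=
    (contDiff_partialDeriv (contDiff_coord hX j) i).differentiable (by simp)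
  have h (i j k : Fin 3) := congrFun (partialDeriv_comm (contDiff_coord hX k) i j) x
  change partialDeriv 0 (fun y => partialDeriv 1 _ y - partialDeriv 2 _ y) x +
    partialDeriv 1 (fun y => partialDeriv 2 _ y - partialDeriv 0 _ y) x +
    partialDeriv 2 (fun y => partialDeriv 0 _ y - partialDeriv 1 _ y) x = 0
  simp only [partialDeriv_sub (hd _ _) (hd _ _)]
  linarith [h 0 1 2, h 1 2 0, h 2 0 1]

/-- Commuting mixed partials gives `curl curl = grad div - lap`. This reduces the div-curl system to
scalar Laplace equations, for both existence and uniqueness of potentials. -/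
theorem curl_curl {X : R3 → R3} (hX : ContDiff ℝ ∞ X) (x : R3) (i : Fin 3) :
    curl (curl X) x i = partialDeriv i (divergence X) x - lap (fun y => X y i) x := by
  rw [curl_eq ((contDiff_curl hX).differentiable (by simp)),
    curl_eq (hX.differentiable (by simp)), divergence_eq (hX.differentiable (by simp))]
  have hd (i j : Fin 3) : Differentiable ℝ (partialDeriv i fun y => X y j) :=
    (contDiff_partialDeriv (contDiff_coord hX j) i).differentiable (by simp)
  have h (i j k : Fin 3) := congrFun (partialDeriv_comm (contDiff_coord hX k) i j) x
  rw [partialDeriv_add (f := fun y => _ + _) ((hd _ _).add (hd _ _)) (hd _ _),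
    partialDeriv_add (hd _ _) (hd _ _)]
  fin_cases i
  · change partialDeriv 1 (fun y => partialDeriv 0 _ y - partialDeriv 1 _ y) x -
      partialDeriv 2 (fun y => partialDeriv 2 _ y - partialDeriv 0 _ y) x = _
    simp only [partialDeriv_sub (hd _ _) (hd _ _), lap, Fin.sum_univ_three, Fin.zero_eta]
    linarith [h 0 1 1, h 0 2 2]
  · change partialDeriv 2 (fun y => partialDeriv 1 _ y - partialDeriv 2 _ y) x -
      partialDeriv 0 (fun y => partialDeriv 0 _ y - partialDeriv 1 _ y) x = _
    simp only [partialDeriv_sub (hd _ _) (hd _ _), lap, Fin.sum_univ_three, Fin.mk_one]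
    linarith [h 1 0 0, h 1 2 2]
  · change partialDeriv 0 (fun y => partialDeriv 2 _ y - partialDeriv 0 _ y) x -
      partialDeriv 1 (fun y => partialDeriv 1 _ y - partialDeriv 2 _ y) x = _
    simp only [partialDeriv_sub (hd _ _) (hd _ _), lap, Fin.sum_univ_three, Fin.reduceFinMk]
    linarith [h 2 0 0, h 2 1 1]

/-- The product rule gives `(Y·∇)X - (X·∇)Y + (div Y) X - (div X) Y`; the hypotheses remove the last
two terms. -/
theorem curl_cross {X Y : R3 → R3} (hX : ContDiff ℝ ∞ X) (hY : ContDiff ℝ ∞ Y)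
    (hX0 : divergence X = 0) (hY0 : divergence Y = 0) :
    curl (cross X Y) = VectorField.lieBracket ℝ Y X := by
  have hm (i j : Fin 3) : Differentiable ℝ fun y => X y i * Y y j :=
    (differentiable_coord hX i).mul (differentiable_coord hY j)
  have hXd := hX.differentiable (by simp)
  have hYd := hY.differentiable (by simp)
  rw [curl_eq ((contDiff_cross hX hY).differentiable (by simp))]
  funext x
  have h1 := congrFun hX0 x
  have h2 := congrFun hY0 x
  simp only [divergence, pd_eq_partialDeriv (hXd x), pd_eq_partialDeriv (hYd x),
    Fin.sum_univ_three, Pi.zero_apply] at h1 h2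
  ext i
  rw [VectorField.lieBracket_eq]
  simp only [PiLp.sub_apply, fderiv_apply_coord, Fin.sum_univ_three, pd_eq_partialDeriv (hXd x),
    pd_eq_partialDeriv (hYd x)]
  fin_cases i
  · change partialDeriv 1 (fun y => X y 0 * Y y 1 - X y 1 * Y y 0) x -
      partialDeriv 2 (fun y => X y 2 * Y y 0 - X y 0 * Y y 2) x = _
    simp only [partialDeriv_sub (hm _ _) (hm _ _),
      partialDeriv_mul (differentiable_coord hX _) (differentiable_coord hY _), Fin.zero_eta]
    linear_combination X x 0 * h2 - Y x 0 * h1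
  · change partialDeriv 2 (fun y => X y 1 * Y y 2 - X y 2 * Y y 1) x -
      partialDeriv 0 (fun y => X y 0 * Y y 1 - X y 1 * Y y 0) x = _
    simp only [partialDeriv_sub (hm _ _) (hm _ _),
      partialDeriv_mul (differentiable_coord hX _) (differentiable_coord hY _), Fin.mk_one]
    linear_combination X x 1 * h2 - Y x 1 * h1
  · change partialDeriv 0 (fun y => X y 2 * Y y 0 - X y 0 * Y y 2) x -
      partialDeriv 1 (fun y => X y 1 * Y y 2 - X y 2 * Y y 1) x = _
    simp only [partialDeriv_sub (hm _ _) (hm _ _),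
      partialDeriv_mul (differentiable_coord hX _) (differentiable_coord hY _), Fin.reduceFinMk]
    linear_combination X x 2 * h2 - Y x 2 * h1

section

open MeasureTheory FourierTransform Real

/-! ## Harmonic functions vanishing at infinity -/

/-- A positive second derivative would make the point a local minimum as well, so `φ` would be
locally constant and its second derivative zero. -/
theorem deriv_deriv_nonpos_of_isLocalMax {φ : ℝ → ℝ} {t : ℝ} (hc : ContinuousAt φ t)
    (h : IsLocalMax φ t) : deriv (deriv φ) t ≤ 0 := by
  by_contra! hpos
  have hmin := isLocalMin_of_deriv_deriv_pos hpos h.deriv_eq_zero hc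
  have hconst : φ =ᶠ[𝓝 t] fun _ => φ t := by
    filter_upwards [h, hmin] with s h1 h2 using le_antisymm h1 h2
  have := hconst.deriv.deriv_eq
  simp at this
  linarith

theorem hasDerivAt_line {f : R3 → ℝ} (hf : Differentiable ℝ f) (i : Fin 3) (x : R3) (t : ℝ) :
    HasDerivAt (fun s : ℝ => f (x + s • stdVec i)) (partialDeriv i f (x + t • stdVec i)) t := by
  have h : HasDerivAt (fun s : ℝ => x + s • stdVec i) (stdVec i) t := by
    simpa using ((hasDerivAt_id t).smul_const (stdVec i)).const_add x
  exact (hf _).hasFDerivAt.comp_hasDerivAt t h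

theorem partialDeriv_partialDeriv_nonpos_of_isLocalMax {f : R3 → ℝ} (hf : ContDiff ℝ ∞ f)
    {x : R3} (h : IsLocalMax f x) (i : Fin 3) : partialDeriv i (partialDeriv i f) x ≤ 0 := by
  have hd := hf.differentiable (by simp)
  have hd' := (contDiff_partialDeriv hf i).differentiable (by simp)
  have h1 : deriv (fun s : ℝ => f (x + s • stdVec i)) =
      fun s => partialDeriv i f (x + s • stdVec i) :=
    funext fun s => (hasDerivAt_line hd i x s).deriv
  have hl : Filter.Tendsto (fun s : ℝ => x + s • stdVec i) (𝓝 0) (𝓝 x) := by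
    have : Continuous fun s : ℝ => x + s • stdVec i := by fun_prop
    simpa using this.tendsto 0
  have h2 : IsLocalMax (fun s : ℝ => f (x + s • stdVec i)) 0 := by
    filter_upwards [hl.eventually h] with s hs
    simpa using hs
  have h3 := deriv_deriv_nonpos_of_isLocalMax (hasDerivAt_line hd i x 0).continuousAt h2
  rw [h1, (hasDerivAt_line hd' i x 0).deriv] at h3
  simpa using h3

theorem lap_add {f g : R3 → ℝ} (hf : ContDiff ℝ ∞ f) (hg : ContDiff ℝ ∞ g) (x : R3) :
    lap (fun y => f y + g y) x = lap f x + lap g x := by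
  simp only [lap, Fin.sum_univ_three]
  simp only [partialDeriv_add (hf.differentiable (by simp)) (hg.differentiable (by simp)),
    partialDeriv_add ((contDiff_partialDeriv hf _).differentiable (by simp))
      ((contDiff_partialDeriv hg _).differentiable (by simp))]
  ring

theorem lap_neg (f : R3 → ℝ) (x : R3) : lap (fun y => -f y) x = -lap f x := by
  simp only [lap, Fin.sum_univ_three, partialDeriv_neg]
  ring

theorem lap_const_mul {f : R3 → ℝ} (hf : ContDiff ℝ ∞ f) (c : ℝ) (x : R3) :
    lap (fun y => c * f y) x = c * lap f x := by
  have h (i : Fin 3) {g : R3 → ℝ} (hg : ContDiff ℝ ∞ g) :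
      partialDeriv i (fun y => c * g y) = fun y => c * partialDeriv i g y := by
    funext y
    simp [partialDeriv, fderiv_const_mul (hg.differentiable (by simp) y)]
  simp only [lap, Fin.sum_univ_three, h _ hf, h _ (contDiff_partialDeriv hf _)]
  ring

theorem partialDeriv_coord (i j : Fin 3) (x : R3) :
    partialDeriv i (fun y => y j) x = if j = i then 1 else 0 := by
  have h : HasFDerivAt (fun y : R3 => y j) (EuclideanSpace.proj j : R3 →L[ℝ] ℝ) x :=
    (EuclideanSpace.proj (𝕜 := ℝ) j).hasFDerivAt
  rw [partialDeriv, h.fderiv]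
  simp [stdVec]

theorem norm_sq_R3 (x : R3) : ‖x‖ ^ 2 = x 0 * x 0 + x 1 * x 1 + x 2 * x 2 := by
  rw [← real_inner_self_eq_norm_sq, inner_R3]

theorem lap_norm_sq (x : R3) : lap (fun y => ‖y‖ ^ 2) x = 6 := by
  have hc (j : Fin 3) : Differentiable ℝ fun y : R3 => y j :=
    differentiable_coord contDiff_id j
  have hm (j : Fin 3) : Differentiable ℝ fun y : R3 => y j * y j := (hc j).mul (hc j)
  have h (i : Fin 3) : partialDeriv i (fun y => ‖y‖ ^ 2) = fun y => y i + y i := by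
    simp only [norm_sq_R3]
    rw [partialDeriv_add (f := fun y => _ + _) ((hm 0).add (hm 1)) (hm 2),
      partialDeriv_add (hm 0) (hm 1)]
    funext y
    simp only [partialDeriv_mul (hc _) (hc _), partialDeriv_coord]
    fin_cases i <;> simp
  simp only [lap, Fin.sum_univ_three, h, partialDeriv_add (hc _) (hc _), partialDeriv_coord]
  norm_num

/-- Maximum principle: adding `ε‖y‖²` raises the Laplacian to `6ε > 0`, which excludes interior
maxima, while a positive value of `u` together with decay would force one. -/
theorem nonpos_of_lap_eq_zero {u : R3 → ℝ} (hu : ContDiff ℝ ∞ u) (h : ∀ x, lap u x = 0)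
    (h0 : Filter.Tendsto u (Filter.cocompact R3) (𝓝 0)) (x : R3) : u x ≤ 0 := by
  by_contra! hx
  obtain ⟨R, hR0, hR⟩ : ∃ R : ℝ, 0 < R ∧ ∀ y, R < ‖y‖ → u y < u x / 2 := by
    have := h0.eventually (gt_mem_nhds (half_pos hx))
    rw [Filter.eventually_iff, Metric.mem_cocompact_iff_closedBall_compl_subset 0] at this
    obtain ⟨r, hr⟩ := this
    refine ⟨max r 1, by positivity, fun y hy => hr ?_⟩
    simpa using (le_max_left r 1).trans_lt hy
  have hxR : ‖x‖ ≤ R := by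
    by_contra! hlt
    linarith [hR x hlt]
  -- Chosen so that `ε (R + 1)² = u x / 4`: where `R < ‖y‖ ≤ R + 1` the perturbed function stays
  -- below `u x / 2 + u x / 4 < u x`. The maximum over the ball of radius `R + 1` is thus attained
  -- within radius `R`, in the interior.
  set ε := u x / (4 * (R + 1) ^ 2) with hε
  have hε0 : 0 < ε := by positivity
  have hq : ContDiff ℝ ∞ fun y : R3 => ‖y‖ ^ 2 := contDiff_norm_sq ℝ
  have hw : ContDiff ℝ ∞ fun y => u y + ε * ‖y‖ ^ 2 := hu.add (contDiff_const.mul hq)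
  obtain ⟨y, hy, hmax⟩ := (isCompact_closedBall (0 : R3) (R + 1)).exists_isMaxOn
    ⟨x, by simpa using hxR.trans (by linarith)⟩ hw.continuous.continuousOn
  rw [mem_closedBall_zero_iff] at hy
  have hxy : u x + ε * ‖x‖ ^ 2 ≤ u y + ε * ‖y‖ ^ 2 :=
    hmax (by simpa using hxR.trans (by linarith))
  have hyR : ‖y‖ ≤ R := by
    by_contra! hlt
    have h1 : ε * ‖y‖ ^ 2 ≤ ε * (R + 1) ^ 2 := by gcongr
    have h2 : ε * (R + 1) ^ 2 = u x / 4 := by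
      rw [hε]
      field_simp
    have h3 : 0 ≤ ε * ‖x‖ ^ 2 := by positivity
    linarith [hR y hlt]
  have hloc : IsLocalMax (fun y => u y + ε * ‖y‖ ^ 2) y :=
    hmax.isLocalMax (Metric.closedBall_mem_nhds_of_mem (by simpa using by linarith))
  have hle : lap (fun y => u y + ε * ‖y‖ ^ 2) y ≤ 0 :=
    Finset.sum_nonpos fun i _ => partialDeriv_partialDeriv_nonpos_of_isLocalMax hw hloc i
  rw [lap_add hu (contDiff_const.mul hq), h, lap_const_mul hq, lap_norm_sq] at hle
  linarith

/-- Liouville's theorem for harmonic functions vanishing at infinity. -/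
theorem eq_zero_of_lap_eq_zero {u : R3 → ℝ} (hu : ContDiff ℝ ∞ u) (h : ∀ x, lap u x = 0)
    (h0 : Filter.Tendsto u (Filter.cocompact R3) (𝓝 0)) : u = 0 := by
  funext x
  refine le_antisymm (nonpos_of_lap_eq_zero hu h h0 x) ?_
  have := nonpos_of_lap_eq_zero hu.neg (fun y => by rw [lap_neg, h, neg_zero])
    (by simpa using h0.neg) x
  simpa using this

/-! ## Solution of the Poisson equation for Schwartz functions -/

/-- Differentiation under the Fourier integral. The result is again the real part of a Fourier
transform, so the lemma can be iterated to compute the Laplacian. -/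
theorem partialDeriv_re_fourier {h : R3 → ℂ} (h0 : Integrable h)
    (h1 : Integrable fun ξ => ‖ξ‖ * ‖h ξ‖) (i : Fin 3) :
    partialDeriv i (fun x => (𝓕 h x).re) =
      fun x => (𝓕 (fun ξ : R3 => -(2 * π * Complex.I) * (ξ i * h ξ)) x).re := by
  funext x
  have hd := Complex.reCLM.hasFDerivAt.comp x (Real.hasFDerivAt_fourier h0 h1 x)
  have hi : Integrable (VectorFourier.fourierSMulRight (innerSL ℝ (E := R3)) h) := by
    refine (h1.const_mul (2 * π * ‖innerSL ℝ (E := R3)‖)).mono'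
      (h0.aestronglyMeasurable.fourierSMulRight) (Filter.Eventually.of_forall fun ξ => ?_)
    simpa [mul_assoc] using VectorFourier.norm_fourierSMulRight_le (innerSL ℝ) h ξ
  have hd' : HasFDerivAt (fun x => (𝓕 h x).re) _ x := hd
  rw [partialDeriv, hd'.fderiv, ContinuousLinearMap.comp_apply,
    Real.fourier_continuousLinearMap_apply hi]
  have hs (ξ : R3) : innerSL ℝ ξ (stdVec i) = ξ i := by
    rw [innerSL_apply_apply, stdVec, EuclideanSpace.inner_single_right]
    simp
  simp only [VectorFourier.fourierSMulRight_apply, smul_eq_mul, Complex.real_smul,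
    Complex.reCLM_apply]
  exact congrArg (fun k : R3 → ℂ => (𝓕 k x).re) (funext fun ξ => by rw [← hs ξ])

/-- Riemann–Lebesgue. Integrability of `h` is not needed, because the integral of a non-integrable
function is 0 by convention. -/
theorem tendsto_re_fourier (h : R3 → ℂ) :
    Filter.Tendsto (fun x => (𝓕 h x).re) (Filter.cocompact R3) (𝓝 0) := by
  have := tendsto_integral_exp_inner_smul_cocompact h
  exact (Complex.continuous_re.tendsto' 0 0 rfl).comp this

/-- Dimension 3 enters here: in polar coordinates the Jacobian `r²` cancels the singular factor,
leaving `1 / (1 + r²)`. -/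
theorem integrable_inv_norm_sq_mul_inv_one_add :
    Integrable fun ξ : R3 => (‖ξ‖ ^ 2)⁻¹ * (1 + ‖ξ‖ ^ 2)⁻¹ := by
  have := (integrable_fun_norm_addHaar (volume : Measure R3)
    (f := fun r : ℝ => (r ^ 2)⁻¹ * (1 + r ^ 2)⁻¹)).2 ?_
  · exact this
  · refine (integrable_inv_one_add_sq.integrableOn (s := Set.Ioi (0 : ℝ))).congr_fun
      (fun r hr => ?_) measurableSet_Ioi
    have hr0 : r ≠ 0 := (Set.mem_Ioi.1 hr).ne'
    simp [hr0]

/-- The Schwartz bounds of orders `n` and `n + 2` add up to `‖ξ‖ⁿ ‖g ξ‖ ≤ (C + D) / (1 + ‖ξ‖²)`,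
which leaves the integrable function of the previous lemma as majorant. -/
theorem integrable_pow_mul_inv_norm_sq_smul (g : 𝓢(R3, ℂ)) (n : ℕ) :
    Integrable fun ξ => ‖ξ‖ ^ n * ‖((4 * π ^ 2 * ‖ξ‖ ^ 2)⁻¹ : ℝ) • g ξ‖ := by
  obtain ⟨C, hC⟩ := g.decay n 0
  obtain ⟨D, hD⟩ := g.decay (n + 2) 0
  refine (integrable_inv_norm_sq_mul_inv_one_add.const_mul ((4 * π ^ 2)⁻¹ * (C + D))).mono' ?_
    (Filter.Eventually.of_forall fun ξ => ?_)
  · have := g.continuous.measurable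
    fun_prop
  · have h1 : (1 + ‖ξ‖ ^ 2) * (‖ξ‖ ^ n * ‖g ξ‖) ≤ C + D := by
      have h2 := hC.2 ξ
      have h3 := hD.2 ξ
      simp only [norm_iteratedFDeriv_zero] at h2 h3
      linear_combination h2 + h3
    have h4 : ‖ξ‖ ^ n * ‖g ξ‖ ≤ (C + D) * (1 + ‖ξ‖ ^ 2)⁻¹ := by
      rw [← div_eq_mul_inv, le_div_iff₀ (by positivity)]
      linarith
    have h5 : ‖((4 * π ^ 2 * ‖ξ‖ ^ 2)⁻¹ : ℝ) • g ξ‖ = (4 * π ^ 2)⁻¹ * (‖ξ‖ ^ 2)⁻¹ * ‖g ξ‖ := by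
      rw [norm_smul, Real.norm_of_nonneg (by positivity), mul_inv]
    rw [Real.norm_of_nonneg (by positivity), h5]
    calc _ = (4 * π ^ 2)⁻¹ * (‖ξ‖ ^ 2)⁻¹ * (‖ξ‖ ^ n * ‖g ξ‖) := by ring
      _ ≤ (4 * π ^ 2)⁻¹ * (‖ξ‖ ^ 2)⁻¹ * ((C + D) * (1 + ‖ξ‖ ^ 2)⁻¹) := by gcongr
      _ = _ := by ring

/-- Every Schwartz function has a smooth Newtonian potential which vanishes at infinity together
with its first derivatives. -/
theorem exists_poisson (f : 𝓢(R3, ℝ)) : ∃ u : R3 → ℝ, ContDiff ℝ ∞ u ∧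
    Filter.Tendsto u (Filter.cocompact R3) (𝓝 0) ∧
    (∀ i, Filter.Tendsto (partialDeriv i u) (Filter.cocompact R3) (𝓝 0)) ∧
    ∀ x, lap u x = -f x := by
  set F : 𝓢(R3, ℂ) := f.postcompCLM Complex.ofRealCLM with hF
  set g : 𝓢(R3, ℂ) := 𝓕⁻ F with hg
  -- The symbol of `-lap` is `4π²‖ξ‖²`. The value at `ξ = 0` is 0 by the convention for inverses,
  -- which matters only on a null set.
  set h : R3 → ℂ := fun ξ => ((4 * π ^ 2 * ‖ξ‖ ^ 2)⁻¹ : ℝ) • g ξ with hh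
  have hmeas : AEStronglyMeasurable h volume := by
    have := g.continuous.measurable
    exact (by fun_prop : Measurable h).aestronglyMeasurable
  have hint (n : ℕ) : Integrable fun ξ => ‖ξ‖ ^ n * ‖h ξ‖ :=
    integrable_pow_mul_inv_norm_sq_smul g n
  have h0 : Integrable h := by
    rw [← integrable_norm_iff hmeas]
    simpa using hint 0
  have h1 : Integrable fun ξ => ‖ξ‖ * ‖h ξ‖ := by simpa using hint 1
  have hcoord (i : Fin 3) : Measurable fun ξ : R3 => ξ i := by fun_prop
  have hmi (i : Fin 3) : AEStronglyMeasurable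
      (fun ξ : R3 => -(2 * π * Complex.I) * (ξ i * h ξ)) volume :=
    ((((Complex.measurable_ofReal.comp (hcoord i)).aestronglyMeasurable).mul hmeas).const_mul _)
  have hni (i : Fin 3) (ξ : R3) :
      ‖-(2 * π * Complex.I) * (ξ i * h ξ)‖ ≤ (2 * π) * (‖ξ‖ * ‖h ξ‖) := by
    have : |ξ i| ≤ ‖ξ‖ := by simpa using PiLp.norm_apply_le ξ i
    simp only [norm_mul, norm_neg, Complex.norm_I, Complex.norm_real, Complex.norm_ofNat,
      Real.norm_eq_abs, abs_of_pos pi_pos, mul_one]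
    gcongr
  have hi0 (i : Fin 3) : Integrable fun ξ : R3 => -(2 * π * Complex.I) * (ξ i * h ξ) :=
    (h1.const_mul (2 * π)).mono' (hmi i) (Filter.Eventually.of_forall (hni i))
  have hi1 (i : Fin 3) :
      Integrable fun ξ : R3 => ‖ξ‖ * ‖-(2 * π * Complex.I) * (ξ i * h ξ)‖ := by
    refine ((hint 2).const_mul (2 * π)).mono' (by have := (hmi i).norm; fun_prop)
      (Filter.Eventually.of_forall fun ξ => ?_)
    rw [Real.norm_of_nonneg (by positivity)]
    calc _ ≤ ‖ξ‖ * ((2 * π) * (‖ξ‖ * ‖h ξ‖)) := by gcongr; exact hni i ξ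
      _ = _ := by ring
  have hii0 (i : Fin 3) : Integrable fun ξ : R3 =>
      -(2 * π * Complex.I) * (ξ i * (-(2 * π * Complex.I) * (ξ i * h ξ))) := by
    refine ((hi1 i).const_mul (2 * π)).mono'
      (((((Complex.measurable_ofReal.comp (hcoord i)).aestronglyMeasurable).mul
        (hmi i)).const_mul _)) (Filter.Eventually.of_forall fun ξ => ?_)
    have : |ξ i| ≤ ‖ξ‖ := by simpa using PiLp.norm_apply_le ξ i
    rw [norm_mul, norm_mul (ξ i : ℂ)]
    simp only [norm_mul (2 * π : ℂ), norm_mul (2 : ℂ), norm_neg, Complex.norm_I,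
      Complex.norm_real, Complex.norm_ofNat, Real.norm_eq_abs, abs_of_pos pi_pos, mul_one]
    gcongr
  refine ⟨fun x => (𝓕 h x).re, ?_, tendsto_re_fourier h, fun i => ?_, fun x => ?_⟩
  · exact Complex.reCLM.contDiff.comp (Real.contDiff_fourier fun n _ => hint n)
  · rw [partialDeriv_re_fourier h0 h1]
    exact tendsto_re_fourier _
  -- Two derivatives multiply by `(-2πi ξᵢ)²`; summed over `i` this is `-4π²‖ξ‖²`, which undoes the
  -- division away from the origin.
  · have hsum : (fun ξ : R3 => ∑ i, -(2 * π * Complex.I) *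
        (ξ i * (-(2 * π * Complex.I) * (ξ i * h ξ)))) =ᵐ[volume] -g := by
      filter_upwards [compl_mem_ae_iff.2 (measure_singleton (0 : R3))] with ξ hξ
      have hξ0 : ‖ξ‖ ≠ 0 := norm_ne_zero_iff.2 hξ
      have hn := norm_sq_R3 ξ
      have hn' : ((‖ξ‖ : ℂ)) ^ 2 = ξ 0 * ξ 0 + ξ 1 * ξ 1 + ξ 2 * ξ 2 := by exact_mod_cast hn
      have hn0 : (‖ξ‖ : ℂ) ≠ 0 := by exact_mod_cast hξ0
      have hp0 : (π : ℂ) ≠ 0 := by exact_mod_cast pi_ne_zero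
      have hid : (4 * π ^ 2 * ‖ξ‖ ^ 2 : ℂ) * h ξ = g ξ := by
        rw [hh]
        simp only [Complex.real_smul]
        push_cast
        field_simp
      simp only [Fin.sum_univ_three, Pi.neg_apply]
      rw [← hid, hn']
      linear_combination (4 * π ^ 2 * (ξ 0 * ξ 0 + ξ 1 * ξ 1 + ξ 2 * ξ 2) * h ξ) * Complex.I_sq
    simp only [lap, partialDeriv_re_fourier h0 h1, partialDeriv_re_fourier (hi0 _) (hi1 _)]
    rw [← Complex.re_sum]
    simp only [Real.fourier_eq]
    rw [← integral_finsetSum]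
    · have : ∫ ξ : R3, ∑ i, 𝐞 (-inner ℝ ξ x) • (-(2 * π * Complex.I) *
          (ξ i * (-(2 * π * Complex.I) * (ξ i * h ξ)))) = -𝓕 (g : R3 → ℂ) x := by
        rw [Real.fourier_eq, ← integral_neg]
        refine integral_congr_ae ?_
        filter_upwards [hsum] with ξ hξ
        rw [← Finset.smul_sum, hξ]
        simp
      rw [this, ← SchwartzMap.fourier_coe, hg, FourierInvPair.fourier_fourierInv_eq]
      simp [hF]
    · intro i _
      exact (Real.fourierIntegral_convergent_iff x).2 (hii0 i)

end

/-! ## Coulomb potentials -/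

theorem tendsto_zero_iff_coord {X : R3 → R3} {l : Filter R3} :
    Filter.Tendsto X l (𝓝 0) ↔ ∀ i, Filter.Tendsto (fun x => X x i) l (𝓝 0) := by
  rw [(EuclideanSpace.equiv (Fin 3) ℝ).toHomeomorph.isInducing.tendsto_nhds_iff, tendsto_pi_nhds]
  rfl

theorem tendsto_add_zero {E : Type*} [NormedAddCommGroup E] {f g : R3 → E} {l : Filter R3}
    (hf : Filter.Tendsto f l (𝓝 0)) (hg : Filter.Tendsto g l (𝓝 0)) :
    Filter.Tendsto (f + g) l (𝓝 0) := by
  have := hf.add hg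
  rw [add_zero] at this
  exact this

theorem tendsto_smul_zero {E : Type*} [NormedAddCommGroup E] [NormedSpace ℝ E] {f : R3 → E}
    {l : Filter R3} (hf : Filter.Tendsto f l (𝓝 0)) (r : ℝ) :
    Filter.Tendsto (r • f) l (𝓝 0) := by
  have := hf.const_smul r
  rw [smul_zero] at this
  exact this

theorem partialDeriv_zero (i : Fin 3) : partialDeriv i 0 = 0 := by
  funext x
  simp [partialDeriv]

theorem lap_eq_zero_of_grad_eq_zero {u : R3 → ℝ} (h : grad u = 0) (x : R3) : lap u x = 0 := by
  have h1 (i : Fin 3) : partialDeriv i u = fun _ => 0 := by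
    funext y
    have := congrArg (fun v : R3 => v i) (congrFun h y)
    fin_cases i <;> simpa [grad] using this
  simp only [lap, h1]
  simp [partialDeriv]

theorem lap_partialDeriv {f : R3 → ℝ} (hf : ContDiff ℝ ∞ f) (j : Fin 3) :
    lap (partialDeriv j f) = partialDeriv j (lap f) := by
  have hd (i : Fin 3) : Differentiable ℝ (partialDeriv i (partialDeriv i f)) :=
    (contDiff_partialDeriv (contDiff_partialDeriv hf i) i).differentiable (by simp)
  have hl : lap f = fun x => partialDeriv 0 (partialDeriv 0 f) x +
      partialDeriv 1 (partialDeriv 1 f) x + partialDeriv 2 (partialDeriv 2 f) x := by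
    funext x
    simp [lap, Fin.sum_univ_three]
  funext x
  rw [hl, partialDeriv_add (f := fun y => _ + _) ((hd 0).add (hd 1)) (hd 2),
    partialDeriv_add (hd 0) (hd 1), lap, Fin.sum_univ_three]
  simp only [partialDeriv_comm (contDiff_partialDeriv hf _) j, partialDeriv_comm hf j]

/-- A divergence-free and curl-free vector field vanishing at infinity is zero. -/
theorem eq_zero_of_curl_eq_zero_of_divergence_eq_zero {W : R3 → R3} (hW : ContDiff ℝ ∞ W)
    (hc : curl W = 0) (hd : divergence W = 0)
    (h0 : Filter.Tendsto W (Filter.cocompact R3) (𝓝 0)) : W = 0 := by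
  have h (i : Fin 3) : (fun x => W x i) = 0 := by
    refine eq_zero_of_lap_eq_zero (contDiff_coord hW i) (fun x => ?_)
      (tendsto_zero_iff_coord.1 h0 i)
    -- With curl and divergence both zero, this identity says that each component of `W` is
    -- harmonic.
    have h1 := curl_curl hW x i
    rw [hc, hd] at h1
    have h2 : curl 0 x i = 0 := by fin_cases i <;> simp [curl, pd]
    rw [h2, partialDeriv_zero] at h1
    simpa using h1.symm
  funext x
  ext i
  exact congrFun (h i) x

theorem IsCoulombPotential.add {b c B C : R3 → R3} (hB : IsCoulombPotential b B)
    (hC : IsCoulombPotential c C) : IsCoulombPotential (b + c) (B + C) where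
  smooth := hB.smooth.add hC.smooth
  curl_eq := by
    rw [curl_add (hB.smooth.differentiable (by simp)) (hC.smooth.differentiable (by simp)),
      hB.curl_eq, hC.curl_eq]
  div_eq := by
    rw [divergence_add (hB.smooth.differentiable (by simp))
      (hC.smooth.differentiable (by simp)), hB.div_eq, hC.div_eq, add_zero]
  decay := tendsto_add_zero hB.decay hC.decay

theorem IsCoulombPotential.smul {b B : R3 → R3} (hB : IsCoulombPotential b B) (r : ℝ) :
    IsCoulombPotential (r • b) (r • B) where
  smooth := hB.smooth.const_smul r
  curl_eq := by rw [curl_smul, hB.curl_eq]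
  div_eq := by rw [divergence_smul, hB.div_eq, smul_zero]
  decay := tendsto_smul_zero hB.decay r

theorem IsCoulombPotential.unique {b B C : R3 → R3} (hB : IsCoulombPotential b B)
    (hC : IsCoulombPotential b C) : B = C := by
  have h := hB.add (hC.smul (-1))
  have h0 := eq_zero_of_curl_eq_zero_of_divergence_eq_zero h.smooth
    (by rw [h.curl_eq]; simp) h.div_eq h.decay
  rw [neg_smul, one_smul, ← sub_eq_add_neg] at h0
  exact sub_eq_zero.1 h0

/-- The `i`-th component of a Schwartz vector field. -/
def schwartzCoord (b : 𝓢(R3, R3)) (i : Fin 3) : 𝓢(R3, ℝ) :=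
  b.postcompCLM (EuclideanSpace.proj i : R3 →L[ℝ] ℝ)

theorem contDiff_fundField (b : divFree) : ContDiff ℝ ∞ (fundField b) :=
  (b : 𝓢(R3, R3)).smooth ⊤

theorem differentiable_fundField (b : divFree) : Differentiable ℝ (fundField b) :=
  (b : 𝓢(R3, R3)).differentiable

theorem divergence_fundField (b : divFree) : divergence (fundField b) = 0 := b.2

theorem tendsto_fundField (b : divFree) :
    Filter.Tendsto (fundField b) (Filter.cocompact R3) (𝓝 0) :=
  (b : 𝓢(R3, R3)).tendsto_cocompact

theorem fundField_lie (b c : divFree) :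
    fundField ⁅b, c⁆ = VectorField.lieBracket ℝ (fundField b) (fundField c) :=
  lie_coe (b : 𝓢(R3, R3)) c

/-- Take `B = curl U`, where `U` is the componentwise Newtonian potential of `b`. Since `div b = 0`,
`div U` is harmonic and vanishes at infinity, hence is zero, and `curl curl U = -lap U = b`. The
decay of `B` is that of the first derivatives of `U`. -/
theorem exists_isCoulombPotential (b : divFree) : ∃ B, IsCoulombPotential (fundField b) B := by
  choose u hu hu0 hu1 hul using fun i => exists_poisson (schwartzCoord b i)
  set U : R3 → R3 := fun x => !₂[u 0 x, u 1 x, u 2 x] with hU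
  have hUs : ContDiff ℝ ∞ U := contDiff_vec (hu 0) (hu 1) (hu 2)
  have hUd : Differentiable ℝ U := hUs.differentiable (by simp)
  have hUi (i : Fin 3) : (fun x => U x i) = u i := by fin_cases i <;> rfl
  have hdU : divergence U = fun x => partialDeriv 0 (u 0) x + partialDeriv 1 (u 1) x +
      partialDeriv 2 (u 2) x := by
    simp only [divergence_eq hUd, hUi]
  have hp (i : Fin 3) : ContDiff ℝ ∞ (partialDeriv i (u i)) := contDiff_partialDeriv (hu i) i
  have hlapu (i : Fin 3) : lap (u i) = fun x => -fundField b x i := funext fun x => hul i x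
  have hdU0 : divergence U = 0 := by
    rw [hdU]
    refine eq_zero_of_lap_eq_zero (((hp 0).add (hp 1)).add (hp 2)) (fun x => ?_)
      (by simpa using ((hu1 0 0).add (hu1 1 1)).add (hu1 2 2))
    have hb := congrFun (divergence_fundField b) x
    rw [divergence_eq (differentiable_fundField b)] at hb
    rw [lap_add (f := fun x => _ + _) ((hp 0).add (hp 1)) (hp 2), lap_add (hp 0) (hp 1),
      lap_partialDeriv (hu 0), lap_partialDeriv (hu 1), lap_partialDeriv (hu 2)]
    simp only [hlapu, partialDeriv_neg]
    rw [Pi.zero_apply] at hb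
    linarith
  refine ⟨curl U, ⟨contDiff_curl hUs, ?_⟩, divergence_curl hUs, ?_⟩
  · funext x
    ext i
    rw [curl_curl hUs, hdU0, hUi, hlapu]
    have h0 : partialDeriv i (0 : R3 → ℝ) x = 0 := by simp [partialDeriv]
    rw [h0]
    ring
  · rw [tendsto_zero_iff_coord, curl_eq hUd]
    simp only [hUi]
    intro i
    fin_cases i
    · simpa using (hu1 2 1).sub (hu1 1 2)
    · simpa using (hu1 0 2).sub (hu1 2 0)
    · simpa using (hu1 1 0).sub (hu1 0 1)

/-- The vector potential of `b` in Coulomb gauge vanishing at infinity. -/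
def coulomb (b : divFree) : R3 → R3 := (exists_isCoulombPotential b).choose

theorem isCoulombPotential_coulomb (b : divFree) :
    IsCoulombPotential (fundField b) (coulomb b) :=
  (exists_isCoulombPotential b).choose_spec

theorem coulomb_add (b c : divFree) : coulomb (b + c) = coulomb b + coulomb c :=
  (isCoulombPotential_coulomb _).unique <| by
    rw [map_add]
    exact (isCoulombPotential_coulomb b).add (isCoulombPotential_coulomb c)

theorem coulomb_smul (r : ℝ) (b : divFree) : coulomb (r • b) = r • coulomb b :=
  (isCoulombPotential_coulomb _).unique <| by
    rw [map_smul]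
    exact (isCoulombPotential_coulomb b).smul r

/-- The map `b ↦ -B`. -/
def comomentOne : divFree →ₗ[ℝ] SmoothForm R3 1 where
  toFun b := ⟨-flat (coulomb b), (contDiff_flat (isCoulombPotential_coulomb b).smooth).neg⟩
  map_add' b c := by
    ext1
    change -flat (coulomb (b + c)) = -flat (coulomb b) + -flat (coulomb c)
    rw [coulomb_add, flat_add, neg_add]
  map_smul' r b := by
    ext1
    change -flat (coulomb (r • b)) = r • -flat (coulomb b)
    rw [coulomb_smul, flat_smul, smul_neg]

theorem coe_comomentOne (b : divFree) :
    (comomentOne b : R3 → R3 [⋀^Fin 1]→L[ℝ] ℝ) = -flat (coulomb b) := rfl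

theorem extDeriv_comomentOne (b : divFree) :
    extDeriv (comomentOne b : R3 → R3 [⋀^Fin 1]→L[ℝ] ℝ) = -iprod (fundField b) nu := by
  have hB := isCoulombPotential_coulomb b
  rw [coe_comomentOne, ← hB.curl_eq, ← extDeriv_flat (hB.smooth.differentiable (by simp))]
  funext x
  have := extDeriv_smul (-1 : ℝ) (flat (coulomb b)) (x := x)
  simp only [neg_smul, one_smul] at this
  exact this

theorem isHamiltonianPair_comomentOne (b : divFree) :
    IsHamiltonianPair nu (comomentOne b : R3 → R3 [⋀^Fin 1]→L[ℝ] ℝ) (fundField b) where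
  smooth := contDiff_fundField b
  preserves := by
    have hB := isCoulombPotential_coulomb b
    have h1 : extDeriv (iprod (fundField b) nu) = 0 := by
      rw [← hB.curl_eq, ← extDeriv_flat (hB.smooth.differentiable (by simp))]
      exact extDeriv_extDeriv (contDiff_infty.1 (contDiff_flat hB.smooth) 2) (by simp)
    rw [lieDeriv, h1, isTwoPlectic_nu.closed, zero_add]
    rfl
  eq := by rw [extDeriv_comomentOne, add_neg_cancel]

/-! ## The function `Δ⁻¹ δ μ₂(b, c)` -/

theorem cross_add_left (X X' Y : R3 → R3) : cross (X + X') Y = cross X Y + cross X' Y := by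
  funext x
  ext i
  fin_cases i <;> simp [cross] <;> ring

theorem cross_smul_left (r : ℝ) (X Y : R3 → R3) : cross (r • X) Y = r • cross X Y := by
  funext x
  ext i
  fin_cases i <;> simp [cross] <;> ring

theorem cross_add_right (X Y Y' : R3 → R3) : cross X (Y + Y') = cross X Y + cross X Y' := by
  funext x
  ext i
  fin_cases i <;> simp [cross] <;> ring

theorem cross_smul_right (r : ℝ) (X Y : R3 → R3) : cross X (r • Y) = r • cross X Y := by
  funext x
  ext i
  fin_cases i <;> simp [cross] <;> ring

theorem cross_self (X : R3 → R3) : cross X X = 0 := by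
  funext x
  ext i
  fin_cases i <;> simp [cross] <;> ring

theorem contDiff_cross_fundField (b c : divFree) :
    ContDiff ℝ ∞ (cross (fundField b) (fundField c)) :=
  contDiff_cross (contDiff_fundField b) (contDiff_fundField c)

theorem tendsto_cross {X Y : R3 → R3} {l : Filter R3} (hX : Filter.Tendsto X l (𝓝 0))
    (hY : Filter.Tendsto Y l (𝓝 0)) : Filter.Tendsto (cross X Y) l (𝓝 0) := by
  rw [tendsto_zero_iff_coord] at *
  intro i
  fin_cases i
  · have := ((hX 1).mul (hY 2)).sub ((hX 2).mul (hY 1))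
    simp only [mul_zero, sub_zero] at this
    exact this
  · have := ((hX 2).mul (hY 0)).sub ((hX 0).mul (hY 2))
    simp only [mul_zero, sub_zero] at this
    exact this
  · have := ((hX 0).mul (hY 1)).sub ((hX 1).mul (hY 0))
    simp only [mul_zero, sub_zero] at this
    exact this

/-- Products and derivatives of Schwartz functions are Schwartz, so `exists_poisson` applies to this
right-hand side. -/
theorem exists_schwartz_divergence_cross (b c : divFree) :
    ∃ φ : 𝓢(R3, ℝ), ⇑φ = divergence (cross (fundField b) (fundField c)) := by
  let P (i j : Fin 3) : 𝓢(R3, ℝ) := SchwartzMap.pairing (ContinuousLinearMap.mul ℝ ℝ)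
    (schwartzCoord b i) (schwartzCoord c j)
  let D (i : Fin 3) (f : 𝓢(R3, ℝ)) : 𝓢(R3, ℝ) := LineDeriv.lineDerivOp (stdVec i) f
  refine ⟨D 0 (P 1 2 - P 2 1) + D 1 (P 2 0 - P 0 2) + D 2 (P 0 1 - P 1 0), ?_⟩
  rw [divergence_eq ((contDiff_cross_fundField b c).differentiable (by simp))]
  rfl

theorem exists_bracketPotential (b c : divFree) : ∃ u : R3 → ℝ, ContDiff ℝ ∞ u ∧
    Filter.Tendsto u (Filter.cocompact R3) (𝓝 0) ∧
    (∀ i, Filter.Tendsto (partialDeriv i u) (Filter.cocompact R3) (𝓝 0)) ∧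
    lap u = -divergence (cross (fundField b) (fundField c)) := by
  obtain ⟨φ, hφ⟩ := exists_schwartz_divergence_cross b c
  obtain ⟨u, h1, h2, h3, h4⟩ := exists_poisson φ
  exact ⟨u, h1, h2, h3, funext fun x => by rw [h4, hφ]; rfl⟩

/-- The function `h` vanishing at infinity with `∑ ∂ᵢ² h = -div (b × c)`. -/
def bracketPotential (b c : divFree) : R3 → ℝ := (exists_bracketPotential b c).choose

theorem contDiff_bracketPotential (b c : divFree) : ContDiff ℝ ∞ (bracketPotential b c) :=
  (exists_bracketPotential b c).choose_spec.1

theorem tendsto_bracketPotential (b c : divFree) :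
    Filter.Tendsto (bracketPotential b c) (Filter.cocompact R3) (𝓝 0) :=
  (exists_bracketPotential b c).choose_spec.2.1

theorem tendsto_partialDeriv_bracketPotential (b c : divFree) (i : Fin 3) :
    Filter.Tendsto (partialDeriv i (bracketPotential b c)) (Filter.cocompact R3) (𝓝 0) :=
  (exists_bracketPotential b c).choose_spec.2.2.1 i

theorem lap_bracketPotential (b c : divFree) :
    lap (bracketPotential b c) = -divergence (cross (fundField b) (fundField c)) :=
  (exists_bracketPotential b c).choose_spec.2.2.2

theorem eq_of_lap_eq {u v : R3 → ℝ} (hu : ContDiff ℝ ∞ u) (hv : ContDiff ℝ ∞ v)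
    (hu0 : Filter.Tendsto u (Filter.cocompact R3) (𝓝 0))
    (hv0 : Filter.Tendsto v (Filter.cocompact R3) (𝓝 0)) (h : lap u = lap v) : u = v := by
  have h0 := eq_zero_of_lap_eq_zero (hu.add hv.neg)
    (fun x => by rw [lap_add hu hv.neg, lap_neg, h]; ring) (by simpa using hu0.add hv0.neg)
  funext x
  linarith [congrFun h0 x, show u x + -v x = (0 : R3 → ℝ) x from congrFun h0 x,
    show (0 : R3 → ℝ) x = 0 from rfl]

/-- Uniqueness transfers bilinearity and vanishing on the diagonal from `b × c` to its potential,
although the latter is obtained by choice. -/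
theorem bracketPotential_eq (b c : divFree) {u : R3 → ℝ} (hu : ContDiff ℝ ∞ u)
    (hu0 : Filter.Tendsto u (Filter.cocompact R3) (𝓝 0))
    (h : lap u = -divergence (cross (fundField b) (fundField c))) :
    bracketPotential b c = u :=
  eq_of_lap_eq (contDiff_bracketPotential b c) hu (tendsto_bracketPotential b c) hu0
    (by rw [lap_bracketPotential, h])

theorem bracketPotential_add_left (b b' c : divFree) :
    bracketPotential (b + b') c = bracketPotential b c + bracketPotential b' c := by
  refine bracketPotential_eq _ _
    ((contDiff_bracketPotential b c).add (contDiff_bracketPotential b' c))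
    (tendsto_add_zero (tendsto_bracketPotential b c) (tendsto_bracketPotential b' c)) ?_
  funext x
  rw [map_add, cross_add_left, divergence_add
    ((contDiff_cross_fundField b c).differentiable (by simp))
    ((contDiff_cross_fundField b' c).differentiable (by simp)), neg_add,
    ← lap_bracketPotential, ← lap_bracketPotential]
  exact lap_add (contDiff_bracketPotential b c) (contDiff_bracketPotential b' c) x

theorem bracketPotential_add_right (b c c' : divFree) :
    bracketPotential b (c + c') = bracketPotential b c + bracketPotential b c' := by
  refine bracketPotential_eq _ _
    ((contDiff_bracketPotential b c).add (contDiff_bracketPotential b c'))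
    (tendsto_add_zero (tendsto_bracketPotential b c) (tendsto_bracketPotential b c')) ?_
  funext x
  rw [map_add, cross_add_right, divergence_add
    ((contDiff_cross_fundField b c).differentiable (by simp))
    ((contDiff_cross_fundField b c').differentiable (by simp)), neg_add,
    ← lap_bracketPotential, ← lap_bracketPotential]
  exact lap_add (contDiff_bracketPotential b c) (contDiff_bracketPotential b c') x

theorem bracketPotential_smul_left (r : ℝ) (b c : divFree) :
    bracketPotential (r • b) c = r • bracketPotential b c := by
  refine bracketPotential_eq _ _ ((contDiff_bracketPotential b c).const_smul r)
    (tendsto_smul_zero (tendsto_bracketPotential b c) r) ?_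
  funext x
  rw [map_smul, cross_smul_left, divergence_smul, ← smul_neg, ← lap_bracketPotential]
  exact lap_const_mul (contDiff_bracketPotential b c) r x

theorem bracketPotential_smul_right (r : ℝ) (b c : divFree) :
    bracketPotential b (r • c) = r • bracketPotential b c := by
  refine bracketPotential_eq _ _ ((contDiff_bracketPotential b c).const_smul r)
    (tendsto_smul_zero (tendsto_bracketPotential b c) r) ?_
  funext x
  rw [map_smul, cross_smul_right, divergence_smul, ← smul_neg, ← lap_bracketPotential]
  exact lap_const_mul (contDiff_bracketPotential b c) r x

theorem bracketPotential_self (b : divFree) : bracketPotential b b = 0 := by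
  refine bracketPotential_eq _ _ contDiff_const tendsto_const_nhds ?_
  rw [cross_self]
  funext x
  simp [lap, divergence, pd, partialDeriv_zero]

theorem curl_cross_fundField (b c : divFree) :
    curl (cross (fundField b) (fundField c)) = fundField ⁅c, b⁆ := by
  rw [curl_cross (contDiff_fundField b) (contDiff_fundField c) (divergence_fundField b)
    (divergence_fundField c), fundField_lie]

/-- Liouville applied to the left side minus the right side. Its curl is `[b, c] + [c, b] = 0`, its
divergence vanishes by the Poisson equation and the Coulomb gauge, and every term vanishes at
infinity. -/
theorem grad_bracketPotential (b c : divFree) :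
    grad (bracketPotential b c) = -(coulomb ⁅b, c⁆ + cross (fundField b) (fundField c)) := by
  have hs := contDiff_bracketPotential b c
  have hB := isCoulombPotential_coulomb ⁅b, c⁆
  have hg := contDiff_grad hs
  have hc := contDiff_cross_fundField b c
  have d {X : R3 → R3} (hX : ContDiff ℝ ∞ X) : Differentiable ℝ X := hX.differentiable (by simp)
  have hBc : ContDiff ℝ ∞ (coulomb ⁅b, c⁆ + cross (fundField b) (fundField c)) :=
    hB.smooth.add hc
  have hdg : divergence (grad (bracketPotential b c)) = lap (bracketPotential b c) := by
    funext x
    rw [divergence_eq (d hg), lap, Fin.sum_univ_three]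
    rfl
  have h := eq_zero_of_curl_eq_zero_of_divergence_eq_zero (hg.add hBc) ?_ ?_ ?_
  · exact eq_neg_of_add_eq_zero_left h
  · have : curl (grad (bracketPotential b c) +
        (coulomb ⁅b, c⁆ + cross (fundField b) (fundField c))) = 0 := by
      rw [curl_add (d hg) (d hBc), curl_add (d hB.smooth) (d hc), curl_grad hs,
        hB.curl_eq, curl_cross_fundField, ← lie_skew c b, map_neg, add_neg_cancel, add_zero]
    exact this
  · have : divergence (grad (bracketPotential b c) +
        (coulomb ⁅b, c⁆ + cross (fundField b) (fundField c))) = 0 := by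
      rw [divergence_add (d hg) (d hBc), divergence_add (d hB.smooth) (d hc), hdg,
        lap_bracketPotential, hB.div_eq]
      simp
    exact this
  · have h1 : Filter.Tendsto (grad (bracketPotential b c)) (Filter.cocompact R3) (𝓝 0) := by
      rw [tendsto_zero_iff_coord]
      intro i
      have := tendsto_partialDeriv_bracketPotential b c i
      fin_cases i <;> exact this
    simpa using h1.add (hB.decay.add (tendsto_cross (tendsto_fundField b) (tendsto_fundField c)))

/-- The bilinear alternating map `(b, c) ↦ Δ⁻¹ δ μ₂(b, c)`. -/
def comomentTwoAlt : divFree [⋀^Fin 2]→ₗ[ℝ] SmoothForm R3 0 where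
  toFun v := ⟨zeroForm (bracketPotential (v 0) (v 1)),
    contDiff_zeroForm_iff.2 (contDiff_bracketPotential _ _)⟩
  map_update_add' v i b c := by
    ext1
    fin_cases i
    · simp only [Fin.zero_eta, Function.update_self, ne_eq, Fin.isValue, one_ne_zero,
        not_false_eq_true, Function.update_of_ne, bracketPotential_add_left]
      rfl
    · simp only [Fin.mk_one, Function.update_self, ne_eq, Fin.isValue, zero_ne_one,
        not_false_eq_true, Function.update_of_ne, bracketPotential_add_right]
      rfl
  map_update_smul' v i r b := by
    ext1
    have h (u : R3 → ℝ) : zeroForm (r • u) = r • zeroForm u := by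
      funext x
      ext w
      rfl
    fin_cases i
    · simp only [Fin.zero_eta, Function.update_self, ne_eq, Fin.isValue, one_ne_zero,
        not_false_eq_true, Function.update_of_ne, bracketPotential_smul_left, h]
      rfl
    · simp only [Fin.mk_one, Function.update_self, ne_eq, Fin.isValue, zero_ne_one,
        not_false_eq_true, Function.update_of_ne, bracketPotential_smul_right, h]
      rfl
  map_eq_zero_of_eq' v i j h hij := by
    have h01 : v 0 = v 1 := by
      fin_cases i <;> fin_cases j <;> simp_all
    ext1
    simp only [h01, bracketPotential_self]
    rfl

/-- The map `b ∧ c ↦ Δ⁻¹ δ μ₂(b, c)`. -/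
def comomentTwo : ⋀[ℝ]^2 divFree →ₗ[ℝ] SmoothForm R3 0 :=
  exteriorPower.alternatingMapLinearEquiv (R := ℝ) (M := divFree) (N := SmoothForm R3 0) (n := 2)
    comomentTwoAlt

theorem coe_comomentTwo_wedge (b c : divFree) :
    (comomentTwo (wedge b c) : R3 → R3 [⋀^Fin 0]→L[ℝ] ℝ) = zeroForm (bracketPotential b c) := by
  rw [comomentTwo, wedge, exteriorPower.alternatingMapLinearEquiv_apply_ιMulti]
  rfl

theorem extDeriv_comomentTwo_wedge (b c : divFree) :
    extDeriv (comomentTwo (wedge b c) : R3 → R3 [⋀^Fin 0]→L[ℝ] ℝ) = muTwo comomentOne b c := by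
  rw [coe_comomentTwo_wedge, extDeriv_zeroForm, grad_bracketPotential, flat_neg, flat_add, muTwo,
    iprod_iprod_nu, coe_comomentOne, neg_add, sub_eq_add_neg]

/-- As `μ₂ = d f₂`, the right-hand side `δ μ₂` is already `Δ f₂`; only uniqueness of the decaying
solution is at stake. -/
theorem isInvLaplacian_iff (b c : divFree) (u : R3 → R3 [⋀^Fin 0]→L[ℝ] ℝ) :
    IsInvLaplacian (codiff (muTwo comomentOne b c)) u ↔ u = comomentTwo (wedge b c) := by
  rw [← extDeriv_comomentTwo_wedge, coe_comomentTwo_wedge]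
  constructor
  · rintro ⟨h1, h2, h3⟩
    obtain ⟨w, rfl⟩ := zeroForm_surjective u
    rw [contDiff_zeroForm_iff] at h1
    rw [codiff_extDeriv_zeroForm h1,
      codiff_extDeriv_zeroForm (contDiff_bracketPotential b c)] at h2
    rw [eq_of_lap_eq h1 (contDiff_bracketPotential b c) (tendsto_zeroForm_iff.1 h3)
      (tendsto_bracketPotential b c) (neg_injective (zeroForm_injective h2))]
  · rintro rfl
    exact ⟨contDiff_zeroForm_iff.2 (contDiff_bracketPotential b c), rfl,
      tendsto_zeroForm_iff.2 (tendsto_bracketPotential b c)⟩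

/-! ## The homotopy co-momentum map -/

theorem contDiff_triple {X Y Z : R3 → R3} (hX : ContDiff ℝ ∞ X) (hY : ContDiff ℝ ∞ Y)
    (hZ : ContDiff ℝ ∞ Z) : ContDiff ℝ ∞ fun x => inner ℝ (cross X Y x) (Z x) :=
  (contDiff_cross hX hY).inner ℝ hZ

/-- For divergence-free fields, `d(ν(X, Y, Z))` is the sum of the contractions of the volume form
with the brackets. -/
theorem partialDeriv_triple {X Y Z : R3 → R3} (hX : ContDiff ℝ ∞ X) (hY : ContDiff ℝ ∞ Y)
    (hZ : ContDiff ℝ ∞ Z) (hX0 : divergence X = 0) (hY0 : divergence Y = 0)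
    (hZ0 : divergence Z = 0) (i : Fin 3) (x : R3) :
    partialDeriv i (fun x => inner ℝ (cross X Y x) (Z x)) x =
      cross (VectorField.lieBracket ℝ X Y) Z x i - cross (VectorField.lieBracket ℝ X Z) Y x i +
        cross (VectorField.lieBracket ℝ Y Z) X x i := by
  have hXd := hX.differentiable (by simp)
  have hYd := hY.differentiable (by simp)
  have hZd := hZ.differentiable (by simp)
  have h1 := congrFun hX0 x
  have h2 := congrFun hY0 x
  have h3 := congrFun hZ0 x
  simp only [divergence, Fin.sum_univ_three, Pi.zero_apply] at h1 h2 h3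
  have hm (i j : Fin 3) : Differentiable ℝ fun y => X y i * Y y j :=
    (differentiable_coord hX i).mul (differentiable_coord hY j)
  have hs (i j : Fin 3) : Differentiable ℝ fun y => X y i * Y y j - X y j * Y y i :=
    (hm i j).sub (hm j i)
  have ht (i j k : Fin 3) : Differentiable ℝ fun y => (X y i * Y y j - X y j * Y y i) * Z y k :=
    (hs i j).mul (differentiable_coord hZ k)
  have e : (fun x => inner ℝ (cross X Y x) (Z x)) = fun x =>
      (X x 1 * Y x 2 - X x 2 * Y x 1) * Z x 0 + (X x 2 * Y x 0 - X x 0 * Y x 2) * Z x 1 +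
        (X x 0 * Y x 1 - X x 1 * Y x 0) * Z x 2 := by
    funext x
    rw [inner_R3]
    rfl
  rw [e, partialDeriv_add (f := fun y => _ + _) ((ht 1 2 0).add (ht 2 0 1)) (ht 0 1 2),
    partialDeriv_add (ht 1 2 0) (ht 2 0 1)]
  simp only [partialDeriv_mul (hs _ _) (differentiable_coord hZ _),
    partialDeriv_sub (hm _ _) (hm _ _),
    partialDeriv_mul (differentiable_coord hX _) (differentiable_coord hY _),
    ← pd_eq_partialDeriv (hXd x), ← pd_eq_partialDeriv (hYd x), ← pd_eq_partialDeriv (hZd x)]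
  -- The two sides differ by the `i`-th component of `(div X) Y × Z + (div Y) Z × X + (div Z) X ×
  -- Y`.
  fin_cases i <;>
  simp only [cross, VectorField.lieBracket_eq, PiLp.sub_apply, fderiv_apply_coord,
    Fin.sum_univ_three]
  · simp
    linear_combination (Y x 1 * Z x 2 - Y x 2 * Z x 1) * h1 +
      (Z x 1 * X x 2 - Z x 2 * X x 1) * h2 + (X x 1 * Y x 2 - X x 2 * Y x 1) * h3
  · simp
    linear_combination (Y x 2 * Z x 0 - Y x 0 * Z x 2) * h1 +
      (Z x 2 * X x 0 - Z x 0 * X x 2) * h2 + (X x 2 * Y x 0 - X x 0 * Y x 2) * h3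
  · simp
    linear_combination (Y x 0 * Z x 1 - Y x 1 * Z x 0) * h1 +
      (Z x 0 * X x 1 - Z x 1 * X x 0) * h2 + (X x 0 * Y x 1 - X x 1 * Y x 0) * h3

/-- Both sides vanish at infinity, so equality of gradients suffices. By `grad_bracketPotential` the
gradient of the left side consists of Coulomb potentials of double brackets, cancelling by Jacobi,
and of cross products, which `partialDeriv_triple` matches with the right side. -/
theorem bracketPotential_boundary (b c e : divFree) (x : R3) :
    bracketPotential ⁅b, c⁆ e x - bracketPotential ⁅b, e⁆ c x + bracketPotential ⁅c, e⁆ b x =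
      -inner ℝ (cross (fundField b) (fundField c) x) (fundField e x) := by
  set u : R3 → ℝ := fun x =>
    bracketPotential ⁅b, c⁆ e x - bracketPotential ⁅b, e⁆ c x + bracketPotential ⁅c, e⁆ b x with hu
  have h (b c : divFree) := contDiff_bracketPotential b c
  have hd (b c : divFree) := (h b c).differentiable (by simp)
  have ht := contDiff_triple (contDiff_fundField b) (contDiff_fundField c) (contDiff_fundField e)
  have htd := ht.differentiable (by simp)
  have hus : ContDiff ℝ ∞ u := ((h _ _).sub (h _ _)).add (h _ _)
  have hlin (b c e : divFree) (y : R3) (i : Fin 3) :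
      coulomb ⁅⁅b, c⁆, e⁆ y i - coulomb ⁅⁅b, e⁆, c⁆ y i + coulomb ⁅⁅c, e⁆, b⁆ y i = 0 := by
    have hj : ⁅⁅b, c⁆, e⁆ + (-1 : ℝ) • ⁅⁅b, e⁆, c⁆ + ⁅⁅c, e⁆, b⁆ = 0 := by
      have := lie_jacobi b c e
      rw [← lie_skew b ⁅c, e⁆, ← lie_skew c ⁅e, b⁆, ← lie_skew e ⁅b, c⁆, ← lie_skew e b] at this
      simp only [neg_lie, neg_neg] at this
      rw [neg_smul, one_smul, ← neg_eq_zero, ← this]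
      abel
    have h0 : coulomb (0 : divFree) = 0 := by simpa using coulomb_smul 0 0
    have := congrArg coulomb hj
    rw [coulomb_add, coulomb_add, coulomb_smul, h0] at this
    have := congrArg (fun v : R3 => v i) (congrFun this y)
    simp only [Pi.add_apply, Pi.smul_apply, PiLp.add_apply, PiLp.smul_apply, smul_eq_mul,
      Pi.zero_apply, PiLp.zero_apply] at this
    linarith
  have hg (b c : divFree) (y : R3) (i : Fin 3) : partialDeriv i (bracketPotential b c) y =
      -(coulomb ⁅b, c⁆ y i + cross (fundField b) (fundField c) y i) := by
    have := congrArg (fun v : R3 => v i) (congrFun (grad_bracketPotential b c) y)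
    fin_cases i <;> exact this
  have hgrad : grad (fun y => u y + inner ℝ (cross (fundField b) (fundField c) y)
      (fundField e y)) = 0 := by
    have hi (y : R3) (i : Fin 3) : partialDeriv i (fun y => u y +
        inner ℝ (cross (fundField b) (fundField c) y) (fundField e y)) y = 0 := by
      rw [partialDeriv_add (hus.differentiable (by simp)) htd]
      beta_reduce
      rw [partialDeriv_triple (contDiff_fundField b) (contDiff_fundField c) (contDiff_fundField e)
          (divergence_fundField b) (divergence_fundField c) (divergence_fundField e), hu,
        partialDeriv_add (f := fun y => _ - _) ((hd _ _).sub (hd _ _)) (hd _ _),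
        partialDeriv_sub (hd _ _) (hd _ _)]
      simp only [hg, ← fundField_lie]
      linarith [hlin b c e y i]
    funext y
    ext i
    fin_cases i <;> exact hi y _
  have h0 := eq_zero_of_lap_eq_zero (hus.add ht) (lap_eq_zero_of_grad_eq_zero hgrad) (by
    have h1 := ((tendsto_bracketPotential ⁅b, c⁆ e).sub
      (tendsto_bracketPotential ⁅b, e⁆ c)).add (tendsto_bracketPotential ⁅c, e⁆ b)
    have h2 := (tendsto_cross (tendsto_fundField b) (tendsto_fundField c)).inner (𝕜 := ℝ)
      (tendsto_fundField e)
    simpa using h1.add h2)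
  exact eq_neg_of_add_eq_zero_left (congrFun h0 x)

theorem isHomotopyComomentumMap_comoment :
    IsHomotopyComomentumMap nu fundField comomentOne comomentTwo where
  action_smooth := contDiff_fundField
  action_lie := fundField_lie
  action_preserves b := (isHamiltonianPair_comomentOne b).preserves
  hamiltonian b := ⟨_, isHamiltonianPair_comomentOne b⟩
  eq_one b := by
    rw [extDeriv_comomentOne]
    simp [sig]
  eq_two b c := by
    rw [extDeriv_comomentTwo_wedge, muTwo, boundaryTwo, map_neg]
    have h2 : sig 2 = 1 := by norm_num [sig]
    rw [h2, one_smul, sub_add_cancel]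
    exact neg_neg _
  eq_three b c e := by
    rw [boundaryThree, map_sub, map_add, map_neg]
    change -(-(comomentTwo (wedge ⁅b, c⁆ e) : R3 → R3 [⋀^Fin 0]→L[ℝ] ℝ) +
      (comomentTwo (wedge ⁅b, e⁆ c) : R3 → R3 [⋀^Fin 0]→L[ℝ] ℝ) -
      (comomentTwo (wedge ⁅c, e⁆ b) : R3 → R3 [⋀^Fin 0]→L[ℝ] ℝ)) = _
    rw [coe_comomentTwo_wedge, coe_comomentTwo_wedge, coe_comomentTwo_wedge, iprod_iprod_nu,
      iprod_flat]
    funext x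
    ext w
    have := bracketPotential_boundary b c e x
    simp [zeroForm_apply, sig]
    linarith

section

open MeasureTheory

/-! ## Loops -/

theorem periodic_deriv {γ : ℝ → R3} (hγ : Function.Periodic γ 1) :
    Function.Periodic (deriv γ) 1 := by
  intro t
  rw [← deriv_comp_add_const, show (fun x => γ (x + 1)) = γ from funext hγ]

theorem Loop.continuous (γ : Loop) : Continuous γ := γ.smooth.continuous

theorem Loop.contDiff_deriv (γ : Loop) : ContDiff ℝ ∞ (deriv γ) :=
  (contDiff_infty_iff_deriv.1 γ.smooth).2

theorem Loop.hasDerivAt (γ : Loop) (t : ℝ) : HasDerivAt γ (deriv γ t) t :=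
  (γ.smooth.differentiable (by simp) t).hasDerivAt

theorem Reparam.hasDerivAt (φ : Reparam) (t : ℝ) : HasDerivAt φ.toFun (deriv φ.toFun t) t :=
  (φ.smooth.differentiable (by simp) t).hasDerivAt

theorem Reparam.deriv_comp (φ : Reparam) (γ : Loop) (t : ℝ) :
    deriv (fun s => γ (φ.toFun s)) t = deriv φ.toFun t • deriv γ (φ.toFun t) :=
  ((γ.hasDerivAt (φ.toFun t)).scomp t (φ.hasDerivAt t)).deriv

/-- Change of variables on the circle. -/
theorem Reparam.integral_comp_mul_deriv (φ : Reparam) {f : ℝ → ℝ} (hf : Continuous f)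
    (hp : Function.Periodic f 1) :
    ∫ t in (0 : ℝ)..1, f (φ.toFun t) * deriv φ.toFun t = ∫ t in (0 : ℝ)..1, f t := by
  have h := intervalIntegral.integral_comp_mul_deriv (a := 0) (b := 1)
    (fun t _ => φ.hasDerivAt t)
    (contDiff_infty_iff_deriv.1 φ.smooth).2.continuous.continuousOn hf
  have h1 : φ.toFun 1 = φ.toFun 0 + 1 := by simpa using φ.shift 0
  refine h.trans ?_
  -- The substitution leads to `[φ 0, φ 0 + 1]`, a full period, which may be shifted to `[0, 1]`.
  rw [h1, hp.intervalIntegral_add_eq (φ.toFun 0) 0, zero_add]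

/-- The cross product of vectors. -/
def crossVec (a b : R3) : R3 :=
  !₂[a 1 * b 2 - a 2 * b 1, a 2 * b 0 - a 0 * b 2, a 0 * b 1 - a 1 * b 0]

theorem contDiff_crossVec {f g : ℝ → R3} (hf : ContDiff ℝ ∞ f) (hg : ContDiff ℝ ∞ g) :
    ContDiff ℝ ∞ fun t => crossVec (f t) (g t) := by
  have h1 := contDiff_euclidean.1 hf
  have h2 := contDiff_euclidean.1 hg
  rw [contDiff_euclidean]
  intro i
  fin_cases i
  · exact ((h1 1).mul (h2 2)).sub ((h1 2).mul (h2 1))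
  · exact ((h1 2).mul (h2 0)).sub ((h1 0).mul (h2 2))
  · exact ((h1 0).mul (h2 1)).sub ((h1 1).mul (h2 0))

theorem inner_crossVec (a b c : R3) : inner ℝ (crossVec a b) c =
    (a 1 * b 2 - a 2 * b 1) * c 0 + (a 2 * b 0 - a 0 * b 2) * c 1 +
      (a 0 * b 1 - a 1 * b 0) * c 2 := by
  rw [inner_R3]
  rfl

/-- Cyclic symmetry of the determinant isolates the velocity in an inner product. -/
theorem Omega_eq (γ u v : ℝ → R3) :
    Omega γ u v = ∫ t in (0 : ℝ)..1, inner ℝ (crossVec (u t) (v t)) (deriv γ t) := by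
  unfold Omega transgress
  congr 1
  funext t
  change vol ![deriv γ t, u t, v t] = _
  rw [vol_apply, inner_crossVec]
  simp
  ring

/-- The expansion of `a × (a × b)`. When `a × b = 0` it exhibits `b` as a multiple of `a`. -/
theorem norm_sq_smul_eq (a b : R3) :
    ‖a‖ ^ 2 • b = inner ℝ a b • a - crossVec a (crossVec a b) := by
  ext i
  rw [norm_sq_R3, inner_R3]
  fin_cases i <;> simp [crossVec] <;> ring

theorem inner_crossVec_crossVec (a b : R3) :
    inner ℝ (crossVec b (crossVec a b)) a = ‖crossVec a b‖ ^ 2 := by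
  rw [norm_sq_R3, inner_R3]
  simp [crossVec]
  ring

theorem omegaDescends : OmegaDescends where
  invariant K φ u v := by
    rw [Omega_eq, Omega_eq]
    have hc : Continuous fun t => inner ℝ (crossVec (u t) (v t)) (deriv K.toFun t) :=
      (contDiff_crossVec u.smooth v.smooth).continuous.inner K.contDiff_deriv.continuous
    rw [← φ.integral_comp_mul_deriv hc]
    · congr 1
      funext t
      rw [φ.deriv_comp K.toLoop, inner_smul_right, mul_comm]
    · intro t
      simp only [u.periodic t, v.periodic t, periodic_deriv K.periodic t]
  kernel K u := by
    constructor
    · intro h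
      have hs := contDiff_crossVec K.contDiff_deriv u.smooth
      -- Testing against `v = γ' × u` turns `Ω(u, v)` into `∫ ‖γ' × u‖²`, so `u` is parallel to `γ'`
      -- everywhere.
      let v : Loop := ⟨fun t => crossVec (deriv K.toFun t) (u t), hs, fun t => by
        simp only [u.periodic t, periodic_deriv K.periodic t]⟩
      have hv : ∫ t in (0 : ℝ)..1, ‖v t‖ ^ 2 = 0 := by
        refine Eq.trans ?_ (h v)
        rw [Omega_eq]
        congr 1
        funext t
        exact (inner_crossVec_crossVec _ _).symm
      have h0 (t : ℝ) : v t = 0 := by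
        obtain ⟨s, hs, hts⟩ := v.periodic.exists_mem_Ico₀ zero_lt_one t
        rw [hts]
        by_contra hne
        have hpos := intervalIntegral.integral_pos (f := fun t => ‖v t‖ ^ 2) zero_lt_one
          (v.continuous.norm.pow 2).continuousOn (fun x _ => by positivity)
          ⟨s, ⟨hs.1, hs.2.le⟩, by positivity⟩
        exact hpos.ne' hv
      refine ⟨fun t => (‖deriv K.toFun t‖ ^ 2)⁻¹ * inner ℝ (deriv K.toFun t) (u t),
        fun t => ?_⟩
      have h1 := norm_sq_smul_eq (deriv K.toFun t) (u t)
      have h2 : crossVec (deriv K.toFun t) (u t) = 0 := h0 t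
      have h3 : crossVec (deriv K.toFun t) 0 = 0 := by
        ext i
        fin_cases i <;> simp [crossVec]
      rw [h2, h3, sub_zero] at h1
      rw [mul_smul, ← h1, inv_smul_smul₀]
      exact pow_ne_zero _ (norm_ne_zero_iff.2 (K.immersed t))
    · rintro ⟨h, hu⟩ v
      rw [Omega_eq]
      have h0 (t : ℝ) : inner ℝ (crossVec (u t) (v t)) (deriv K.toFun t) = 0 := by
        rw [hu, inner_crossVec]
        simp
        ring
      simp [h0]

/-! ## Circulations -/

theorem continuous_circulation_integrand {B : R3 → R3} (hB : Continuous B) (γ : Loop) :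
    Continuous fun t => inner ℝ (B (γ t)) (deriv γ t) :=
  (hB.comp γ.continuous).inner γ.contDiff_deriv.continuous

theorem circulation_add {B C : R3 → R3} (hB : Continuous B) (hC : Continuous C) (γ : Loop) :
    circulation (B + C) γ = circulation B γ + circulation C γ := by
  unfold circulation
  rw [← intervalIntegral.integral_add
    ((continuous_circulation_integrand hB γ).intervalIntegrable _ _)
    ((continuous_circulation_integrand hC γ).intervalIntegrable _ _)]
  simp only [Pi.add_apply, inner_add_left]

theorem circulation_smul (r : ℝ) (B : R3 → R3) (γ : ℝ → R3) :
    circulation (r • B) γ = r * circulation B γ := by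
  unfold circulation
  rw [← intervalIntegral.integral_const_mul]
  simp only [Pi.smul_apply, inner_smul_left, conj_trivial]

theorem circulation_neg (B : R3 → R3) (γ : ℝ → R3) :
    circulation (-B) γ = -circulation B γ := by
  rw [← neg_one_smul ℝ B, circulation_smul, neg_one_mul]

theorem circulation_reparam {B : R3 → R3} (hB : Continuous B) (γ : Loop) (φ : Reparam) :
    circulation B (fun t => γ (φ.toFun t)) = circulation B γ := by
  unfold circulation
  rw [← φ.integral_comp_mul_deriv (continuous_circulation_integrand hB γ)]
  · congr 1
    funext t
    rw [φ.deriv_comp, inner_smul_right, mul_comm]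
  · intro t
    simp only [γ.periodic t, periodic_deriv γ.periodic t]

/-- The antisymmetric part of the Jacobian acts as the cross product with the curl. It serves both
the Poincaré lemma and the first variation. -/
theorem inner_fderiv_sub_inner_fderiv (W : R3 → R3) (x v w : R3) :
    inner ℝ (fderiv ℝ W x v) w - inner ℝ (fderiv ℝ W x w) v =
      inner ℝ (crossVec (curl W x) v) w := by
  rw [inner_R3, inner_R3, inner_crossVec]
  simp only [fderiv_apply_coord, Fin.sum_univ_three, curl]
  simp
  ring

/-- A curl-free vector field has no circulation. -/
theorem circulation_eq_zero_of_curl_eq_zero {W : R3 → R3} (hW : ContDiff ℝ ∞ W)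
    (hc : curl W = 0) (γ : Loop) : circulation W γ = 0 := by
  have hd : Differentiable ℝ fun x => innerSL ℝ (W x) :=
    (innerSL ℝ).differentiable.comp (hW.differentiable (by simp))
  have hf (a v w : R3) : fderiv ℝ (fun x => innerSL ℝ (W x)) a v w =
      inner ℝ (fderiv ℝ W a v) w := by
    have := (innerSL ℝ).hasFDerivAt.comp a (hW.differentiable (by simp) a).hasFDerivAt
    have h' : HasFDerivAt (fun x => innerSL ℝ (W x)) _ a := this
    rw [h'.fderiv]
    rfl
  -- Poincaré lemma: zero curl makes the derivative symmetric, so `W` is the gradient of some `g`,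
  -- and the integral telescopes around the closed loop.
  obtain ⟨g, hg⟩ := convex_univ.exists_forall_hasFDerivAt_of_fderiv_symmetric isOpen_univ
    hd.differentiableOn fun a _ v w => by
      have := inner_fderiv_sub_inner_fderiv W a v w
      rw [hc, inner_crossVec] at this
      rw [hf, hf, ← sub_eq_zero, this]
      simp
  have h1 (t : ℝ) : HasDerivAt (fun t => g (γ t)) (inner ℝ (W (γ t)) (deriv γ t)) t :=
    (hg (γ t) trivial).comp_hasDerivAt t (γ.hasDerivAt t)
  unfold circulation
  rw [intervalIntegral.integral_eq_sub_of_hasDerivAt (fun t _ => h1 t)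
    ((continuous_circulation_integrand hW.continuous γ).intervalIntegrable _ _)]
  have := γ.periodic 0
  rw [zero_add] at this
  rw [this, sub_self]

theorem IsVectorPotential.circulation_eq {b B C : R3 → R3} (hB : IsVectorPotential b B)
    (hC : IsVectorPotential b C) (γ : Loop) : circulation B γ = circulation C γ := by
  have hC' : ContDiff ℝ ∞ ((-1 : ℝ) • C) := contDiff_const.smul hC.smooth
  have hBC : ContDiff ℝ ∞ (B + (-1 : ℝ) • C) := hB.smooth.add hC'
  have hc : curl (B + (-1 : ℝ) • C) = 0 := by
    rw [curl_add (hB.smooth.differentiable (by simp)) (hC'.differentiable (by simp)), curl_smul,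
      hB.curl_eq, hC.curl_eq, neg_smul, one_smul, add_neg_cancel]
  have h := circulation_eq_zero_of_curl_eq_zero hBC hc γ
  rw [circulation_add hB.smooth.continuous hC'.continuous, circulation_smul] at h
  linarith

theorem continuous_coulomb (b : divFree) : Continuous (coulomb b) :=
  (isCoulombPotential_coulomb b).smooth.continuous

/-- The Rasetti–Regge current `λ_b`. -/
def rasettiRegge : divFree →ₗ[ℝ] (Brylinski → ℝ) where
  toFun b := Quotient.lift (fun K : Knot => circulation (coulomb b) K) (by
    rintro K K' ⟨φ, h⟩
    rw [show K'.toFun = fun t => K (φ.toFun t) from funext h]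
    exact (circulation_reparam (continuous_coulomb b) K.toLoop φ).symm)
  map_add' b c := by
    funext y
    induction y using Quotient.inductionOn with
    | h K =>
      change circulation (coulomb (b + c)) K = circulation _ K + circulation _ K
      rw [coulomb_add]
      exact circulation_add (continuous_coulomb b) (continuous_coulomb c) K.toLoop
  map_smul' r b := by
    funext y
    induction y using Quotient.inductionOn with
    | h K =>
      change circulation (coulomb (r • b)) K = r * circulation _ K
      rw [coulomb_smul, circulation_smul]

theorem rasettiRegge_mk (b : divFree) (K : Knot) :
    rasettiRegge b K.mk' = circulation (coulomb b) K := rfl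

theorem transgress_comomentOne (b : divFree) (γ : ℝ → R3) :
    transgress (comomentOne b : R3 → R3 [⋀^Fin 1]→L[ℝ] ℝ) γ ![] = -circulation (coulomb b) γ := by
  unfold transgress circulation
  rw [← intervalIntegral.integral_neg]
  rfl

/-! ## Variation of the circulation -/

/-- Differentiation under the integral sign for smooth integrands. -/
theorem hasDerivAt_integral_of_contDiff {Φ : ℝ × ℝ → ℝ} (hΦ : ContDiff ℝ ∞ Φ) :
    HasDerivAt (fun s => ∫ t in (0 : ℝ)..1, Φ (s, t))
      (∫ t in (0 : ℝ)..1, fderiv ℝ Φ (0, t) (1, 0)) 0 := by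
  have hd : Differentiable ℝ Φ := hΦ.differentiable (by simp)
  have hc : Continuous fun p => fderiv ℝ Φ p (1, 0) :=
    ((hΦ.fderiv_right (m := ∞) (by simp)).clm_apply contDiff_const).continuous
  obtain ⟨C, hC⟩ := (isCompact_Icc.prod isCompact_Icc :
    IsCompact (Set.Icc (-1 : ℝ) 1 ×ˢ Set.Icc (0 : ℝ) 1)).exists_bound_of_continuousOn
    hc.continuousOn
  refine (intervalIntegral.hasDerivAt_integral_of_dominated_loc_of_deriv_le
    (F := fun s t => Φ (s, t)) (F' := fun s t => fderiv ℝ Φ (s, t) (1, 0))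
    (bound := fun _ => C) (Icc_mem_nhds (a := (-1 : ℝ)) (b := 1) (by norm_num) (by norm_num))
    (Filter.Eventually.of_forall fun s => ?_) ?_ ?_ ?_ ?_ ?_).2
  · exact (hΦ.continuous.comp (by fun_prop : Continuous fun t : ℝ => (s, t))).aestronglyMeasurable
  · exact (hΦ.continuous.comp
      (by fun_prop : Continuous fun t : ℝ => ((0 : ℝ), t))).intervalIntegrable _ _
  · exact (hc.comp (by fun_prop : Continuous fun t : ℝ => ((0 : ℝ), t))).aestronglyMeasurable
  · refine Filter.Eventually.of_forall fun t ht s hs => hC (s, t) ⟨hs, ?_⟩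
    rw [Set.uIoc_of_le zero_le_one] at ht
    exact ⟨ht.1.le, ht.2⟩
  · exact intervalIntegrable_const
  · refine Filter.Eventually.of_forall fun t _ s _ => ?_
    have h : HasDerivAt (fun s : ℝ => (s, t)) (1, 0) s :=
      (hasDerivAt_id s).prodMk (hasDerivAt_const s t)
    exact (hd (s, t)).hasFDerivAt.comp_hasDerivAt s h

/-- First variation of the circulation. -/
theorem hasDerivAt_circulation {B : R3 → R3} (hB : ContDiff ℝ ∞ B) (Γ : ℝ → Loop) (u : ℝ → R3)
    (hΓ : ContDiff ℝ ∞ fun p : ℝ × ℝ => Γ p.1 p.2)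
    (hu : ∀ t, HasDerivAt (fun s => Γ s t) (u t) 0) :
    HasDerivAt (fun s => circulation B (Γ s))
      (Omega (Γ 0) (fun t => curl B (Γ 0 t)) u) 0 := by
  set G : ℝ × ℝ → R3 := fun p => Γ p.1 p.2 with hG
  have hGd : Differentiable ℝ G := hΓ.differentiable (by simp)
  have hBd : Differentiable ℝ B := hB.differentiable (by simp)
  have hDG : ContDiff ℝ ∞ (fderiv ℝ G) := hΓ.fderiv_right (by simp)
  have hDGd : Differentiable ℝ (fderiv ℝ G) := hDG.differentiable (by simp)
  have hΦ (e : ℝ × ℝ) : ContDiff ℝ ∞ fun p => inner ℝ (B (G p)) (fderiv ℝ G p e) :=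
    (hB.comp hΓ).inner ℝ (hDG.clm_apply contDiff_const)
  have hΦd (e f p : ℝ × ℝ) : fderiv ℝ (fun p => inner ℝ (B (G p)) (fderiv ℝ G p e)) p f =
      inner ℝ (B (G p)) (fderiv ℝ (fderiv ℝ G) p f e) +
        inner ℝ (fderiv ℝ B (G p) (fderiv ℝ G p f)) (fderiv ℝ G p e) := by
    have h1 : HasFDerivAt (fun p => B (G p)) _ p :=
      (hBd (G p)).hasFDerivAt.comp p (hGd p).hasFDerivAt
    have h2 := (hDGd p).hasFDerivAt.clm_apply (hasFDerivAt_const e p)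
    rw [(h1.inner ℝ h2).fderiv]
    simp
  have hline (s t : ℝ) : HasDerivAt (fun t : ℝ => (s, t)) (0, 1) t :=
    (hasDerivAt_const t s).prodMk (hasDerivAt_id t)
  have hGt (s t : ℝ) : fderiv ℝ G (s, t) (0, 1) = deriv (Γ s) t :=
    ((hGd (s, t)).hasFDerivAt.comp_hasDerivAt t (hline s t)).deriv.symm
  have hGs (t : ℝ) : fderiv ℝ G (0, t) (1, 0) = u t := by
    have h : HasDerivAt (fun s : ℝ => (s, t)) (1, 0) 0 :=
      (hasDerivAt_id 0).prodMk (hasDerivAt_const 0 t)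
    have h' : HasDerivAt (fun s => Γ s t) (fderiv ℝ G (0, t) (1, 0)) 0 :=
      (hGd (0, t)).hasFDerivAt.comp_hasDerivAt_of_eq 0 h rfl
    exact h'.unique (hu t)
  have hsymm (p : ℝ × ℝ) : fderiv ℝ (fderiv ℝ G) p (1, 0) (0, 1) =
      fderiv ℝ (fderiv ℝ G) p (0, 1) (1, 0) :=
    ((contDiff_infty.1 hΓ 2).contDiffAt.isSymmSndFDerivAt (by simp)).eq _ _
  have hmain := hasDerivAt_integral_of_contDiff (hΦ (0, 1))
  have hcirc : (fun s => circulation B (Γ s)) =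
      fun s => ∫ t in (0 : ℝ)..1, inner ℝ (B (G (s, t))) (fderiv ℝ G (s, t) (0, 1)) := by
    funext s
    simp only [hGt]
    rfl
  rw [hcirc]
  refine hmain.congr_deriv ?_
  have hup : u 1 = u 0 := by
    have h := hu 1
    have h01 : (fun s => Γ s 1) = fun s => Γ s 0 := by
      funext s
      simpa using (Γ s).periodic 0
    rw [h01] at h
    exact h.unique (hu 0)
  have hΨ (t : ℝ) : HasDerivAt (fun t => inner ℝ (B (G (0, t))) (fderiv ℝ G (0, t) (1, 0)))
      (fderiv ℝ (fun p => inner ℝ (B (G p)) (fderiv ℝ G p (1, 0))) (0, t) (0, 1)) t :=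
    ((hΦ (1, 0)).differentiable (by simp) (0, t)).hasFDerivAt.comp_hasDerivAt t (hline 0 t)
  have hcont (e f : ℝ × ℝ) : Continuous fun t : ℝ =>
      fderiv ℝ (fun p => inner ℝ (B (G p)) (fderiv ℝ G p e)) (0, t) f :=
    ((((hΦ e).fderiv_right (m := ∞) (by simp)).clm_apply contDiff_const).continuous).comp
      (by fun_prop : Continuous fun t : ℝ => ((0 : ℝ), t))
  -- The total derivative `∂ₜ⟨B, ∂ₛγ⟩` integrates to zero over a period. Subtracting it cancels the
  -- mixed second derivative of the variation and leaves only the curl term.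
  have hzero : ∫ t in (0 : ℝ)..1,
      fderiv ℝ (fun p => inner ℝ (B (G p)) (fderiv ℝ G p (1, 0))) (0, t) (0, 1) = 0 := by
    rw [intervalIntegral.integral_eq_sub_of_hasDerivAt (fun t _ => hΨ t)
      ((hcont _ _).intervalIntegrable _ _), hGs, hGs, hup]
    have : Γ 0 1 = Γ 0 0 := by simpa using (Γ 0).periodic 0
    simp [hG, this]
  refine (sub_zero _).symm.trans ?_
  refine (congrArg (_ - ·) hzero.symm).trans ?_
  rw [← intervalIntegral.integral_sub
    ((hcont _ _).intervalIntegrable _ _) ((hcont _ _).intervalIntegrable _ _), Omega_eq]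
  congr 1
  funext t
  rw [hΦd, hΦd, hsymm, hGs, hGt, ← inner_fderiv_sub_inner_fderiv]
  simp only [hG]
  ring

theorem isBrylinskiComomentumMap_rasettiRegge : IsBrylinskiComomentumMap (-rasettiRegge) where
  hamiltonian b Γ u hΓ hu := by
    have hB := isCoulombPotential_coulomb b
    have h := hasDerivAt_circulation hB.smooth (fun s => (Γ s).toLoop) u hΓ hu
    rw [hB.curl_eq] at h
    exact h.neg
  bracket b c K := by
    -- `-b × c` is a potential of `[b, c]`, not necessarily in Coulomb gauge, but the circulation
    -- does not depend on the gauge.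
    have hv : IsVectorPotential (fundField ⁅b, c⁆) (-cross (fundField b) (fundField c)) :=
      ⟨(contDiff_cross_fundField b c).neg, by
        rw [← neg_one_smul ℝ, curl_smul, curl_cross_fundField, ← lie_skew, map_neg, neg_smul,
          one_smul, neg_neg]⟩
    have h : (-rasettiRegge) ⁅b, c⁆ K.mk' = -circulation (coulomb ⁅b, c⁆) K := rfl
    rw [h, (isCoulombPotential_coulomb ⁅b, c⁆).toIsVectorPotential.circulation_eq hv K.toLoop,
      circulation_neg, neg_neg, Omega_eq]
    rfl

end

/-! ## Failure of equivariance -/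

theorem curl_congr {X Y : R3 → R3} {x : R3} (h : X =ᶠ[𝓝 x] Y) : curl X =ᶠ[𝓝 x] curl Y := by
  filter_upwards [h.fderiv (𝕜 := ℝ)] with y hy
  simp only [curl, pd, hy]

theorem hasCompactSupport_curl {X : R3 → R3} (hX : HasCompactSupport X) :
    HasCompactSupport (curl X) :=
  (hX.fderiv ℝ).comp_left (g := fun A : R3 →L[ℝ] R3 =>
    (!₂[A (stdVec 1) 2 - A (stdVec 2) 1, A (stdVec 2) 0 - A (stdVec 0) 2,
      A (stdVec 0) 1 - A (stdVec 1) 0] : R3)) (by ext i; fin_cases i <;> simp)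

theorem partialDeriv_comp_coord_zero {p : ℝ → ℝ} {p' : ℝ} {x : R3} (hp : HasDerivAt p p' (x 0))
    (i : Fin 3) : partialDeriv i (fun y => p (y 0)) x = if (0 : Fin 3) = i then p' else 0 := by
  have h : HasFDerivAt (fun y : R3 => y 0) (EuclideanSpace.proj (0 : Fin 3) : R3 →L[ℝ] ℝ) x :=
    (EuclideanSpace.proj (𝕜 := ℝ) (0 : Fin 3)).hasFDerivAt
  have h' : HasFDerivAt (fun y : R3 => p (y 0)) _ x := hp.comp_hasFDerivAt x h
  rw [partialDeriv, h'.fderiv]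
  simp [stdVec]

theorem contDiff_shear {p q : ℝ → ℝ} (hp : ContDiff ℝ ∞ p) (hq : ContDiff ℝ ∞ q) :
    ContDiff ℝ ∞ fun x : R3 => (!₂[0, p (x 0), q (x 0)] : R3) :=
  contDiff_vec contDiff_const (hp.comp (contDiff_coord contDiff_id 0))
    (hq.comp (contDiff_coord contDiff_id 0))

/-- Shears depending on `x₀` alone are stable under curl, so iterated curls reduce to derivatives in
one variable. -/
theorem curl_shear {p q p' q' : ℝ → ℝ} (hps : ContDiff ℝ ∞ p) (hqs : ContDiff ℝ ∞ q)
    (hp : ∀ t, HasDerivAt p (p' t) t) (hq : ∀ t, HasDerivAt q (q' t) t) :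
    curl (fun x : R3 => (!₂[0, p (x 0), q (x 0)] : R3)) = fun x => !₂[0, -q' (x 0), p' (x 0)] := by
  rw [curl_eq ((contDiff_shear hps hqs).differentiable (by simp))]
  funext x
  have h0 (i : Fin 3) : partialDeriv i
      (fun y : R3 => (!₂[0, p (y 0), q (y 0)] : R3) 0) x = 0 :=
    congrFun (partialDeriv_zero i) x
  have h1 (i : Fin 3) : partialDeriv i
      (fun y : R3 => (!₂[0, p (y 0), q (y 0)] : R3) 1) x = _ :=
    partialDeriv_comp_coord_zero (hp (x 0)) i
  have h2 (i : Fin 3) : partialDeriv i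
      (fun y : R3 => (!₂[0, p (y 0), q (y 0)] : R3) 2) x = _ :=
    partialDeriv_comp_coord_zero (hq (x 0)) i
  simp only [h0, h1, h2]
  ext i
  fin_cases i <;> simp

/-- In Cartan's formula the term `ι_b d f₁(b) = -ι_b ι_b ν` vanishes, leaving `d(ι_b f₁(b)) = -d(B ·
b)`. -/
theorem lieDeriv_comomentOne_self (b : divFree) :
    lieDeriv (fundField b) (comomentOne b : R3 → R3 [⋀^Fin 1]→L[ℝ] ℝ) =
      flat (grad fun x => -inner ℝ (coulomb b x) (fundField b x)) := by
  have h1 : iprod (fundField b) (comomentOne b : R3 → R3 [⋀^Fin 1]→L[ℝ] ℝ) =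
      zeroForm fun x => -inner ℝ (coulomb b x) (fundField b x) := rfl
  have h2 : iprod (fundField b) (-iprod (fundField b) nu) = 0 := by
    have h3 : iprod (fundField b) (-iprod (fundField b) nu) =
        -iprod (fundField b) (iprod (fundField b) nu) := rfl
    rw [h3, iprod_iprod_nu, cross_self]
    funext x
    ext w
    simp [flat_apply]
  rw [lieDeriv, extDeriv_comomentOne, h1, h2, extDeriv_zeroForm, add_zero]

/-- There is a field `b ∈ 𝔤` whose helicity density `b · B` is not constant. -/
theorem exists_grad_inner_coulomb_ne_zero :
    ∃ b : divFree, grad (fun x => -inner ℝ (coulomb b x) (fundField b x)) ≠ 0 := by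
  let χ : ContDiffBump (0 : R3) := ⟨1, 2, by norm_num, by norm_num⟩
  -- Here `curl P = (0, x₀², 1)` and `curl curl P = (0, 0, 2x₀)`, whose inner product `2x₀` is not
  -- constant. The cutoff `χ` equals 1 near the origin and makes the fields compactly supported,
  -- hence Schwartz.
  set P : R3 → R3 := fun x => !₂[0, x 0, -(x 0) ^ 3 / 3] with hP
  have hPs : ContDiff ℝ ∞ P := contDiff_shear (p := fun t => t) (q := fun t => -t ^ 3 / 3)
    contDiff_id (by fun_prop)
  set A : R3 → R3 := fun x => χ x • P x with hA
  have hAs : ContDiff ℝ ∞ A := χ.contDiff.smul hPs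
  have hAc : HasCompactSupport A := χ.hasCompactSupport.smul_right
  have hAP : A =ᶠ[𝓝 0] P := by
    filter_upwards [χ.eventuallyEq_one] with x hx
    simp [hA, hx]
  have hBs := contDiff_curl hAs
  have hBc := hasCompactSupport_curl hAc
  have hbs := contDiff_curl hBs
  have hbc := hasCompactSupport_curl hBc
  let b : divFree := ⟨hbc.toSchwartzMap hbs, divergence_curl hBs⟩
  have hb : fundField b = curl (curl A) := rfl
  -- The field `curl A` is divergence-free and compactly supported, so by uniqueness it is the
  -- Coulomb potential of its own curl.
  have hB : coulomb b = curl A := (isCoulombPotential_coulomb b).unique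
    ⟨⟨hBs, hb.symm⟩, divergence_curl hAs, (hBc.toSchwartzMap hBs).tendsto_cocompact⟩
  have hc1 : curl P = fun x => !₂[0, -(-(x 0) ^ 2), 1] :=
    curl_shear (p := fun t => t) (q := fun t => -t ^ 3 / 3) (q' := fun t => -t ^ 2)
      (p' := fun _ => 1) contDiff_id (by fun_prop) hasDerivAt_id fun t => by
        have : HasDerivAt (fun t : ℝ => -t ^ 3 / 3) _ t := (hasDerivAt_pow 3 t).neg.div_const 3
        exact this.congr_deriv (by norm_num; ring)
  have hc2 : curl (curl P) = fun x => !₂[0, -0, 2 * x 0] := by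
    rw [hc1]
    exact curl_shear (p := fun t => -(-t ^ 2)) (q := fun _ => 1) (q' := fun _ => 0)
      (p' := fun t => 2 * t) (by fun_prop) contDiff_const
      (fun t => by simpa using hasDerivAt_pow 2 t) fun t => hasDerivAt_const t 1
  have hB' : coulomb b =ᶠ[𝓝 0] curl P := hB ▸ curl_congr hAP
  have hb' : fundField b =ᶠ[𝓝 0] curl (curl P) := hb ▸ curl_congr (curl_congr hAP)
  have hin : (fun x => -inner ℝ (coulomb b x) (fundField b x)) =ᶠ[𝓝 0]
      fun x : R3 => -(2 * x 0) := by
    filter_upwards [hB', hb'] with x h1 h2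
    rw [h1, h2, hc2, hc1, inner_R3]
    simp
  refine ⟨b, fun h => ?_⟩
  have h0 : partialDeriv 0 (fun x => -inner ℝ (coulomb b x) (fundField b x)) 0 = 0 :=
    congrArg (fun v : R3 => v 0) (congrFun h 0)
  have h1 : partialDeriv 0 (fun x : R3 => -(2 * x 0)) 0 = -2 := by
    have hd : HasDerivAt (fun t : ℝ => -(2 * t)) (-2) ((0 : R3) 0) := by
      have : HasDerivAt (fun t : ℝ => -(2 * t)) _ ((0 : R3) 0) :=
        ((hasDerivAt_id ((0 : R3) 0)).const_mul 2).neg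
      exact this.congr_deriv (by norm_num)
    simpa using partialDeriv_comp_coord_zero hd 0
  rw [partialDeriv, hin.fderiv_eq] at h0
  rw [partialDeriv, h0] at h1
  norm_num at h1

theorem exists_lieDeriv_comomentOne_ne : ∃ b : divFree,
    lieDeriv (fundField b) (comomentOne b : R3 → R3 [⋀^Fin 1]→L[ℝ] ℝ) ≠ comomentOne ⁅b, b⁆ := by
  obtain ⟨b, hb⟩ := exists_grad_inner_coulomb_ne_zero
  refine ⟨b, fun h => hb (flat_injective ?_)⟩
  rw [← lieDeriv_comomentOne_self, h, lie_self, map_zero]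
  funext x
  ext w
  simp [flat_apply]

theorem not_isEquivariant_comoment : ¬ IsEquivariant fundField comomentOne comomentTwo := by
  intro h
  obtain ⟨b, hb⟩ := exists_lieDeriv_comomentOne_ne
  exact hb (h.one b b)

end Hydro

end

/-! ### Assembly of the theorem -/

theorem theorem2p1 :
    IsTwoPlectic nu ∧
    (∀ (b c : divFree) (x : R3), fundField ⁅c, b⁆ x = curl (cross (fundField b) (fundField c)) x) ∧
    (∀ b : divFree, ∃! B : R3 → R3, IsCoulombPotential (fundField b) B) ∧
    ∃ (f₁ : divFree →ₗ[ℝ] SmoothForm R3 1) (f₂ : ⋀[ℝ]^2 divFree →ₗ[ℝ] SmoothForm R3 0),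
      -- the explicit formulas `f₁(b) = -B` and `f₂ = Δ⁻¹ δ μ₂`
      (∀ (b : divFree) (B : R3 → R3), IsCoulombPotential (fundField b) B →
        (f₁ b : R3 → R3 [⋀^Fin 1]→L[ℝ] ℝ) = -flat B) ∧
      (∀ (b c : divFree) (u : R3 → R3 [⋀^Fin 0]→L[ℝ] ℝ),
        IsInvLaplacian (codiff (muTwo f₁ b c)) u ↔ u = f₂ (wedge b c)) ∧
      -- (i)
      IsHomotopyComomentumMap nu fundField f₁ f₂ ∧
      -- (ii)
      OmegaDescends ∧
      (∃ lam : divFree →ₗ[ℝ] (Brylinski → ℝ),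
        (∀ (b : divFree) (B : R3 → R3), IsVectorPotential (fundField b) B →
          ∀ K : Knot, lam b K.mk' = circulation B K) ∧
        (∀ (b : divFree) (B : R3 → R3), IsVectorPotential (fundField b) B →
          ∀ γ : Loop, transgress (f₁ b : R3 → R3 [⋀^Fin 1]→L[ℝ] ℝ) γ ![] = -circulation B γ) ∧
        (∀ (b : divFree) (K : Knot),
          transgress (f₁ b : R3 → R3 [⋀^Fin 1]→L[ℝ] ℝ) K ![] = -lam b K.mk') ∧
        IsBrylinskiComomentumMap (-lam)) ∧
      -- (iii)
      (∀ b c : divFree,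
        IsHamiltonianPair nu (f₁ b : R3 → R3 [⋀^Fin 1]→L[ℝ] ℝ) (fundField b) ∧
        formBracket nu (fundField b) (fundField c) - (f₁ ⁅b, c⁆ : R3 → R3 [⋀^Fin 1]→L[ℝ] ℝ) =
          -extDeriv (f₂ (wedge b c) : R3 → R3 [⋀^Fin 0]→L[ℝ] ℝ)) ∧
      -- (iv)
      ¬ IsEquivariant fundField f₁ f₂ ∧
      ∃ b : divFree, lieDeriv (fundField b) (f₁ b : R3 → R3 [⋀^Fin 1]→L[ℝ] ℝ) ≠ f₁ ⁅b, b⁆ := by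
  refine ⟨isTwoPlectic_nu, fun b c x => ?_, fun b => ?_, comomentOne, comomentTwo, fun b B hB => ?_,
    isInvLaplacian_iff, isHomotopyComomentumMap_comoment, omegaDescends,
    ⟨rasettiRegge, fun b B hB K => ?_, fun b B hB γ => ?_, fun b K => ?_,
      isBrylinskiComomentumMap_rasettiRegge⟩,
    fun b c => ⟨isHamiltonianPair_comomentOne b, ?_⟩, not_isEquivariant_comoment,
    exists_lieDeriv_comomentOne_ne⟩
  · rw [curl_cross_fundField]
  · exact ⟨coulomb b, isCoulombPotential_coulomb b, fun B hB =>
      hB.unique (isCoulombPotential_coulomb b)⟩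
  · rw [coe_comomentOne, hB.unique (isCoulombPotential_coulomb b)]
  · exact (isCoulombPotential_coulomb b).toIsVectorPotential.circulation_eq hB K.toLoop
  · rw [transgress_comomentOne,
      (isCoulombPotential_coulomb b).toIsVectorPotential.circulation_eq hB γ]
  · rw [transgress_comomentOne, rasettiRegge_mk]
  · rw [extDeriv_comomentTwo_wedge, muTwo, formBracket, neg_sub]
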